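/- Let $A_n$ be the alternating group on $\{1,\dots,n\}$. For $f:A_n\to\{\pm1\}$ put $P(f)=\Pr_{x,y}[f(x)f(y)=f(xy)]$, where $x,y$ are independent and uniform in $A_n$, and call $f$ zero-mean if $\mathbb{E}_x f(x)=0$. 1. For $n\ge 2$ let $H\le A_n$ be the subgroup of even permutations that map $\{1,2\}$ to itself. There is an isomorphism $e:S_{n-2}\to H$ such that, when $S_{n-2}$ acts on the last $n-2$ points, $e(\sigma)$ agrees with $\sigma$ on these points (so $e(\sigma)$ switches the first two points exactly when $\sigma$ is odd), and $[A_n:H]=\binom n2$. If $n\ge5$, then moreover $H$ has a set $T$ of left coset representatives with $c^2=1$ for all $c\in T$, and there is a zero-mean $f:A_n\to\{\pm1\}$ with $f(e(\sigma))=\operatorname{sgn}(\sigma)$ for all $\sigma\in S_{n-2}$ and $$P(f)\ \ge\ \frac12\Bigl(1+\frac1{\binom n2}\Bigr).$$ 2. For $n\ge6$ the smallest dimension of a nontrivial irreducible complex representation of $A_n$ is $n-1$, and every zero-mean $f:A_n\to\{\pm1\}$ satisfies $$P(f)\ \le\ \frac12\Bigl(1+\frac1{\sqrt{n-1}}\Bigr).$$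 3. Consequently the best achievable bias $\max_f\bigl(P(f)-\tfrac12\bigr)$ over zero-mean $f:A_n\to\{\pm1\}$ is $\Omega(n^{-2})$ and $O(n^{-1/2})$: there are absolute constants $c,C>0$ such that for every $n\ge4$ this maximum exists and $$c\,n^{-2}\ \le\ \max_f\bigl(P(f)-\tfrac12\bigr)\ \le\ C\,n^{-1/2}.$$ -/

import Mathlib

open Finset Equiv BigOperators

namespace ApproxParity

noncomputable section

/-- The probability that `f x * f y = f (x * y)` for `x`, `y` independent and uniform in the finite
group `G`, where `ℤˣ = {1, -1}`. -/
def homProb {G : Type*} [Group G] [Fintype G] (f : G → ℤˣ) : ℝ :=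
  ((univ.filter fun p : G × G => f p.1 * f p.2 = f (p.1 * p.2)).card : ℝ) /
    (Fintype.card (G × G) : ℝ)

/-- The expectation of `f` at a uniformly random point of `G` is zero. -/
def IsZeroMean {G : Type*} [Fintype G] (f : G → ℤˣ) : Prop :=
  𝔼 x, (((f x : ℤˣ) : ℤ) : ℝ) = 0

/-- The biases `Pr[f x * f y = f (x * y)] - 1/2` of the zero-mean functions `f : A_n → {1, -1}`. -/
def biases (n : ℕ) : Set ℝ :=
  {b | ∃ f : alternatingGroup (Fin n) → ℤˣ, IsZeroMean f ∧ b = homProb f - 1 / 2}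

/-- The subgroup of `A_n` of the even permutations that map the set of the first two points
to itself. -/
def pairSubgroup (n : ℕ) : Subgroup (alternatingGroup (Fin n)) where
  carrier := {g | ∀ i : Fin n, ((g : Perm (Fin n)) i : ℕ) < 2 ↔ (i : ℕ) < 2}
  mul_mem' := by
    intro a b ha hb i
    exact (ha ((b : Perm (Fin n)) i)).trans (hb i)
  one_mem' := by
    intro i
    exact Iff.rfl
  inv_mem' := by
    intro a ha i
    have h := ha (((a⁻¹ : alternatingGroup (Fin n)) : Perm (Fin n)) i)
    have h1 : (a : Perm (Fin n)) (((a⁻¹ : alternatingGroup (Fin n)) : Perm (Fin n)) i) = i := by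
      simp
    rw [h1] at h
    exact h.symm

/-- The inclusion of `n - 2` points as the last `n - 2` of `n` points. -/
def lastPoint {n : ℕ} (i : Fin (n - 2)) : Fin n :=
  ⟨i + 2, by omega⟩

/-- The dimensions of the nontrivial irreducible complex representations of `G`. -/
def nontrivialIrrepDims (G : Type*) [Group G] : Set ℕ :=
  {d | ∃ ρ : Representation ℂ G (Fin d → ℂ), ρ.IsIrreducible ∧ ρ ≠ 1}

end

end ApproxParity

/-! Lower bound. Let c be a section of A_n → A_n/H with values of square 1 and c(H) = 1. Put s(x) =
sgn(c(xH)⁻¹x), read through H ≅ S_{n-2}, and multiply s by independent random signs on the cosets,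
normalised to be 1 on H. In the expectation of Σ f(x)f(y)f(xy) only those (x, y) survive for which
the four cosets xH, yH, xyH, H coincide in pairs. The pairs with y ∈ H contribute |G||H|. For y ∉ H
there remain two sums of real characters over intersections H ∩ gHg⁻¹, which are nonnegative; that
the representatives are involutions turns the second sum into this shape. So some choice of signs
has normalised bias at least 1/[G:H] (`exists_zeroMean_extension`).

Upper bound. The sum Σ f(x)f(y)f(xy) is ⟨f, Tf⟩ for the operator T with kernel f(x⁻¹z). It commutes
with left translations and kills constants, so for T ≠ 0 its top singular space is a nontrivial
representation. If D is a lower bound for the dimensions of these, the Hilbert–Schmidt norm |G| of T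
gives ‖T‖ ≤ |G|/√D (`homProb_le_of_rep_eq_one`).

Dimensions. That representations of A_n of dimension at most n - 2 are trivial
(`rep_eq_one_of_finrank_lt`) goes by induction from n - 3 to n. A nontrivial ρ is faithful, as A_n
is simple. The eigenspaces of a three-cycle r are representations of the copy of A_{n-3} on the
other points; if ρ(r) - 1 had rank above 2 they would all be too small for a nontrivial action
(`finrank_displacement_rotR_le`). Rank at most 2 gives a vector fixed by the pointwise stabilizer of
two points (`exists_vector_fixed_by_pair_stabilizer`); this rests on A_6 having no nontrivial
representation of dimension at most 3. The translates of that vector behave like differences e_j -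
e_i of basis vectors, which forces dimension at least n - 1 (`le_finrank_add_one_of_vector`). -/

namespace ApproxParity

open Module

/-! ### Alternating groups on embedded sets of points -/

section Embedding

theorem sign_viaEmbedding {k n : ℕ} (ι : Fin k ↪ Fin n) (σ : Perm (Fin k)) :
    Perm.sign (σ.viaEmbedding ι) = Perm.sign σ := by
  classical
  rw [← Perm.sign_extendDomain σ (ofInjective ι.1 ι.2)]
  unfold Perm.viaEmbedding
  congr!

theorem exists_viaEmbedding_eq {k n : ℕ} (ι : Fin k ↪ Fin n) {g : Perm (Fin n)}
    (hg : ∀ x, (∀ y, ι y ≠ x) → g x = x) : ∃ σ : Perm (Fin k), σ.viaEmbedding ι = g := by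
  have hr : ∀ x, (x ∈ Set.range ι) ↔ g x ∈ Set.range ι := by
    intro x
    constructor
    · intro hx
      by_contra h
      have h1 := hg (g x) (by simpa using h)
      rw [g.injective h1] at h
      exact h hx
    · intro hx
      by_contra h
      rw [hg x (by simpa using h)] at hx
      exact h hx
  let e := ofInjective ι ι.injective
  let s : Perm (Fin k) := (e.permCongr.symm) (g.subtypePerm (fun x => (hr x).symm))
  refine ⟨s, ?_⟩
  ext1 x
  by_cases hx : ∃ y, ι y = x
  · obtain ⟨y, rfl⟩ := hx
    rw [Perm.viaEmbedding_apply]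
    have : e (s y) = ⟨g (ι y), (hr _).1 ⟨y, rfl⟩⟩ := by
      simp [s, permCongr, equivCongr]
      rfl
    exact congrArg Subtype.val this
  · rw [Perm.viaEmbedding_apply_of_notMem _ _ _ (by simpa using hx), hg x (by simpa using hx)]

/-- The homomorphism of alternating groups induced by an embedding of the points. -/
noncomputable def alternatingEmb {k n : ℕ} (ι : Fin k ↪ Fin n) :
    alternatingGroup (Fin k) →* alternatingGroup (Fin n) :=
  ((Perm.viaEmbeddingHom ι).comp (alternatingGroup (Fin k)).subtype).codRestrict _ (by
    intro σ
    rw [Perm.mem_alternatingGroup, ← Perm.mem_alternatingGroup.1 σ.2]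
    exact sign_viaEmbedding ι σ)

variable {k n : ℕ} (ι : Fin k ↪ Fin n) (σ : alternatingGroup (Fin k))

theorem alternatingEmb_apply (x : Fin k) :
    (alternatingEmb ι σ : Perm (Fin n)) (ι x) = ι ((σ : Perm (Fin k)) x) :=
  Perm.viaEmbedding_apply _ _ _

theorem alternatingEmb_apply_of_notMem {x : Fin n} (hx : ∀ y, ι y ≠ x) :
    (alternatingEmb ι σ : Perm (Fin n)) x = x :=
  Perm.viaEmbedding_apply_of_notMem _ _ _ (by rintro ⟨y, hy⟩; exact hx y hy)

theorem alternatingEmb_injective : Function.Injective (alternatingEmb ι) := by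
  intro σ τ h
  apply Subtype.ext
  apply Perm.viaEmbeddingHom_injective ι
  exact congrArg Subtype.val h

/-- Only the values of the embeddings at points moved by σ matter. This permits redirecting an
embedding at a point that σ fixes. -/
theorem alternatingEmb_congr {ι κ : Fin k ↪ Fin n}
    (h : ∀ x, ι x = κ x ∨ (σ : Perm (Fin k)) x = x) (h' : ∀ x, (σ : Perm (Fin k)) x = x ∨
      ι ((σ : Perm (Fin k)) x) = κ ((σ : Perm (Fin k)) x)) :
    alternatingEmb ι σ = alternatingEmb κ σ := by
  have key : ∀ (ι κ : Fin k ↪ Fin n), (∀ x, ι x = κ x ∨ (σ : Perm (Fin k)) x = x) →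
      (∀ x, (σ : Perm (Fin k)) x = x ∨ ι ((σ : Perm (Fin k)) x) = κ ((σ : Perm (Fin k)) x)) →
      ∀ x, (alternatingEmb ι σ : Perm (Fin n)) (ι x) = (alternatingEmb κ σ : Perm (Fin n)) (ι x) := by
    intro ι κ h h' x
    rw [alternatingEmb_apply]
    rcases eq_or_ne ((σ : Perm (Fin k)) x) x with hx | hx
    · rw [hx]
      by_cases hy : ∃ y, κ y = ι x
      · obtain ⟨y, hy⟩ := hy
        rw [← hy, alternatingEmb_apply]
        rcases eq_or_ne ((σ : Perm (Fin k)) y) y with hz | hz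
        · rw [hz]
        · have h1 := (h y).resolve_right hz
          have : y = x := ι.injective (by rw [h1, hy])
          exact absurd (this ▸ hx) (this ▸ hz)
      · rw [alternatingEmb_apply_of_notMem]
        simpa using hy
    · have h1 := (h x).resolve_right hx
      rw [h1, alternatingEmb_apply]
      exact (h' x).resolve_left hx
  apply Subtype.ext
  ext1 x
  by_cases hx : ∃ y, ι y = x
  · obtain ⟨y, rfl⟩ := hx
    exact key ι κ h h' y
  · by_cases hz : ∃ y, κ y = x
    · obtain ⟨y, rfl⟩ := hz
      exact (key κ ι (fun x => (h x).imp_left Eq.symm) (fun x => (h' x).imp_right Eq.symm) y).symm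
    · rw [alternatingEmb_apply_of_notMem, alternatingEmb_apply_of_notMem]
      · simpa using hz
      · simpa using hx

theorem mem_range_alternatingEmb {g : alternatingGroup (Fin n)}
    (hg : ∀ x, (∀ y, ι y ≠ x) → (g : Perm (Fin n)) x = x) : ∃ σ, alternatingEmb ι σ = g := by
  obtain ⟨s, hs⟩ := exists_viaEmbedding_eq ι hg
  refine ⟨⟨s, ?_⟩, Subtype.ext hs⟩
  rw [Perm.mem_alternatingGroup, ← sign_viaEmbedding ι s, hs]
  exact g.2

end Embedding

/-! ### Generation by the three-cycles through two given points -/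

section Generation

/-- Conjugating (a b k) by (a b c) gives (b c k), and inverting it gives (b a k). So the
distinguished ordered pair can be moved step by step to any other. -/
theorem threeCycle_mem_of_pair {α : Type*} [DecidableEq α] {S : Subgroup (Perm α)} {a b : α}
    (hab : a ≠ b) (h : ∀ k, k ≠ a → k ≠ b → swap a b * swap b k ∈ S) {c d e : α} (hcd : c ≠ d)
    (hce : c ≠ e) (hde : d ≠ e) : swap c d * swap d e ∈ S := by
  have conj : ∀ (g : Perm α) (x y z w : α), g * (swap x y * swap z w) * g⁻¹ =
      swap (g x) (g y) * swap (g z) (g w) := by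
    intro g x y z w
    simp only [swap_apply_apply]
    group
  have symm : ∀ a b : α, a ≠ b → (∀ k, k ≠ a → k ≠ b → swap a b * swap b k ∈ S) →
      ∀ k, k ≠ b → k ≠ a → swap b a * swap a k ∈ S := by
    intro a b hab h k hkb hka
    have : swap b a * swap a k = (swap a b * swap b k)⁻¹ := by
      have h1 := swap_apply_apply (swap b a) a k
      rw [swap_apply_right, swap_apply_of_ne_of_ne hkb hka] at h1
      rw [mul_inv_rev, swap_inv, swap_inv, h1, swap_inv, swap_comm a b]
      simp [mul_assoc]
    rw [this]
    exact S.inv_mem (h k hka hkb)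
  have step : ∀ a b c : α, a ≠ b → c ≠ a → c ≠ b → (∀ k, k ≠ a → k ≠ b → swap a b * swap b k ∈ S) →
      ∀ k, k ≠ b → k ≠ c → swap b c * swap c k ∈ S := by
    intro a b c hab hca hcb h k hkb hkc
    by_cases hka : k = a
    · subst hka
      have h1 := conj (swap k b * swap b c) k b b c
      have e1 : (swap k b * swap b c) k = b := by
        simp [swap_apply_of_ne_of_ne hab hca.symm]
      have e2 : (swap k b * swap b c) b = c := by
        simp [swap_apply_of_ne_of_ne hca hcb]
      have e3 : (swap k b * swap b c) c = k := by simp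
      rw [e1, e2, e3] at h1
      rw [← h1]
      exact S.mul_mem (S.mul_mem (h c hca hcb) (h c hca hcb)) (S.inv_mem (h c hca hcb))
    · have h1 := conj (swap a b * swap b c) a b b k
      have e1 : (swap a b * swap b c) a = b := by
        simp [swap_apply_of_ne_of_ne hab hca.symm]
      have e2 : (swap a b * swap b c) b = c := by
        simp [swap_apply_of_ne_of_ne hca hcb]
      have e3 : (swap a b * swap b c) k = k := by
        simp [swap_apply_of_ne_of_ne hkb hkc, swap_apply_of_ne_of_ne hka hkb]
      rw [e1, e2, e3] at h1
      rw [← h1]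
      exact S.mul_mem (S.mul_mem (h c hca hcb) (h k hka hkb)) (S.inv_mem (h c hca hcb))
  have fromb : ∀ y, y ≠ a → y ≠ b → ∀ k, k ≠ b → k ≠ y → swap b y * swap y k ∈ S :=
    fun y hya hyb => step a b y hab hya hyb h
  have froma : ∀ y, y ≠ a → y ≠ b → ∀ k, k ≠ a → k ≠ y → swap a y * swap y k ∈ S :=
    fun y hya hyb => step b a y hab.symm hyb hya (symm a b hab h)
  have fromb' : ∀ y, y ≠ b → ∀ k, k ≠ b → k ≠ y → swap b y * swap y k ∈ S := by
    intro y hyb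
    by_cases hya : y = a
    · subst hya; exact symm _ b hab h
    · exact fromb y hya hyb
  have all : ∀ x y, x ≠ y → ∀ k, k ≠ x → k ≠ y → swap x y * swap y k ∈ S := by
    intro x y hxy
    by_cases hxb : x = b
    · subst hxb; exact fromb' y hxy.symm
    · by_cases hyb : y = b
      · subst hyb; exact symm _ _ hxy.symm (fromb' x hxy)
      · exact step b x y (Ne.symm hxb) hyb hxy.symm (fromb' x hxb)
  exact all c d hcd e hce.symm hde.symm

theorem eq_top_of_threeCycles_mem {n : ℕ} {S : Subgroup (alternatingGroup (Fin n))} {a b : Fin n}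
    (hab : a ≠ b) (h : ∀ g : alternatingGroup (Fin n), ∀ k, k ≠ a → k ≠ b →
      (g : Perm (Fin n)) = swap a b * swap b k → g ∈ S) : S = ⊤ := by
  rw [eq_top_iff, ← alternatingGroup.closure_isThreeCycles_eq_top, Subgroup.closure_le]
  intro g hg
  have hS : ∀ σ ∈ S.map (alternatingGroup (Fin n)).subtype, ∀ hσ : σ ∈ alternatingGroup (Fin n),
      (⟨σ, hσ⟩ : alternatingGroup (Fin n)) ∈ S := by
    rintro _ ⟨σ, hσ, rfl⟩ h
    exact hσ
  obtain ⟨x, hx⟩ := hg.isCycle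
  have hsupp := Perm.mem_support.2 hx.1
  have h1 := (hg.eq_swap_mul_swap_iff_mem_support).2 hsupp
  have h2 := (hg.nodup_iff_mem_support).2 hsupp
  refine hS (g : Perm (Fin n)) ?_ g.2
  rw [h1]
  simp only [List.nodup_cons, List.mem_cons, List.not_mem_nil, or_false, not_or] at h2
  refine threeCycle_mem_of_pair hab ?_ h2.1.1 h2.1.2 h2.2.1
  intro k hka hkb
  have hc := (Perm.isThreeCycle_swap_mul_swap_same hab.symm hkb.symm hka.symm).mem_alternatingGroup
  rw [swap_comm b a] at hc
  exact ⟨⟨_, hc⟩, h _ k hka hkb rfl, rfl⟩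

end Generation

/-! ### Representations of the tetrahedral group A_4 -/

section Tetrahedral

variable {G V : Type*} [Group G] [AddCommGroup V] [Module ℂ V]

/-- The relations between two double transpositions of four points and a rotation of order three
that permutes the double transpositions. -/
structure IsTetrahedral (a b g : G) : Prop where
  aa : a * a = 1
  bb : b * b = 1
  ab : a * b = b * a
  ga : g * a = b * g
  gb : g * b = a * b * g
  ggg : g * g * g = 1

theorem IsTetrahedral.map {a b g : G} (h : IsTetrahedral a b g) {H : Type*} [Group H]
    (φ : G →* H) : IsTetrahedral (φ a) (φ b) (φ g) where
  aa := by rw [← map_mul, h.aa, map_one]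
  bb := by rw [← map_mul, h.bb, map_one]
  ab := by rw [← map_mul, h.ab, map_mul]
  ga := by rw [← map_mul, h.ga, map_mul]
  gb := by rw [← map_mul, h.gb, map_mul, map_mul]
  ggg := by rw [← map_mul, ← map_mul, h.ggg, map_one]

variable {a b g : G} (h : IsTetrahedral a b g) (ρ : Representation ℂ G V)
include h

/-- Every vector in the image of (1 + a)(1 - b) = 1 + a - b - ab has these eigenvalues. If this
operator vanishes, so does its conjugate 1 + b - ab - a under g. Adding the two gives ab = 1, hence
a = b, and then gb = abg forces a = 1. -/
theorem IsTetrahedral.exists_vector (ha : ρ a ≠ 1) :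
    ∃ y : V, y ≠ 0 ∧ ρ a y = y ∧ ρ b y = -y := by
  have raa : ρ a * ρ a = 1 := by rw [← map_mul, h.aa, map_one]
  have rbb : ρ b * ρ b = 1 := by rw [← map_mul, h.bb, map_one]
  have rab : ρ b * ρ a = ρ a * ρ b := by rw [← map_mul, ← map_mul, h.ab]
  have rga : ρ g * ρ a = ρ b * ρ g := by rw [← map_mul, h.ga, map_mul]
  have rgb : ρ g * ρ b = ρ a * ρ b * ρ g := by rw [← map_mul, h.gb, map_mul, map_mul]
  have rgi : ρ g * ρ g⁻¹ = 1 := by rw [← map_mul, mul_inv_cancel, map_one]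
  by_cases hP : 1 + ρ a - ρ b - ρ a * ρ b = 0
  · exfalso
    have conj : ∀ x y : End ℂ V, ρ g * x = y * ρ g → x = 0 → y = 0 := by
      intro x y hxy hx
      have : y = y * ρ g * ρ g⁻¹ := by rw [mul_assoc, rgi, mul_one]
      rw [this, ← hxy, hx, mul_zero, zero_mul]
    have h2 : 1 + ρ b - ρ a * ρ b - ρ a = 0 := by
      refine conj _ _ ?_ hP
      have : ρ g * (ρ a * ρ b) = ρ a * ρ g := by
        rw [← mul_assoc, rga, mul_assoc, rgb, ← mul_assoc, ← mul_assoc, rab, mul_assoc (ρ a), rbb,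
          mul_one]
      rw [mul_sub, mul_sub, mul_add, rga, rgb, this]
      noncomm_ring
    have h3 : ρ a * ρ b = 1 := by
      have : (2 : ℂ) • (1 - ρ a * ρ b) = 0 := by
        rw [two_smul]
        calc _ = (1 + ρ a - ρ b - ρ a * ρ b) + (1 + ρ b - ρ a * ρ b - ρ a) := by abel
          _ = 0 := by rw [hP, h2, add_zero]
      exact (sub_eq_zero.1 ((smul_eq_zero.1 this).resolve_left two_ne_zero)).symm
    have h4 : ρ a = ρ b := by
      calc ρ a = ρ a * (ρ b * ρ b) := by rw [rbb, mul_one]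
        _ = ρ b := by rw [← mul_assoc, h3, one_mul]
    have hgp : ρ a = 1 := by
      have : ρ g * ρ a = ρ g := by rw [rga, ← h4, show ρ a * ρ g = ρ a * ρ b * ρ g by
        rw [← rgb, ← h4, rga, ← h4], h3, one_mul]
      calc ρ a = ρ (g⁻¹ * g) * ρ a := by simp
        _ = ρ g⁻¹ * (ρ g * ρ a) := by rw [map_mul, mul_assoc]
        _ = 1 := by rw [this, ← map_mul, inv_mul_cancel, map_one]
    exact ha hgp
  · obtain ⟨x, hx⟩ : ∃ x, (1 + ρ a - ρ b - ρ a * ρ b) x ≠ 0 := by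
      by_contra hc
      push Not at hc
      exact hP (LinearMap.ext hc)
    refine ⟨_, hx, ?_, ?_⟩
    · rw [← Module.End.mul_apply]
      congr 1
      calc _ = ρ a + ρ a * ρ a - ρ a * ρ b - ρ a * ρ a * ρ b := by noncomm_ring
        _ = _ := by rw [raa]; noncomm_ring
    · rw [← Module.End.mul_apply, ← LinearMap.neg_apply]
      congr 1
      calc _ = ρ b + ρ b * ρ a - ρ b * ρ b - ρ b * ρ a * ρ b := by noncomm_ring
        _ = ρ b + ρ a * ρ b - ρ b * ρ b - ρ a * (ρ b * ρ b) := by rw [rab]; noncomm_ring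
        _ = _ := by rw [rbb]; noncomm_ring

/-- Conjugation by g permutes a, b, ab cyclically, so g permutes the three nontrivial characters of
the Klein group. The independence below holds because these characters are distinct. -/
theorem IsTetrahedral.apply_rotated {y : V} (hya : ρ a y = y) (hyb : ρ b y = -y) :
    ρ a (ρ g y) = -ρ g y ∧ ρ b (ρ g y) = ρ g y ∧
      ρ a (ρ g (ρ g y)) = -ρ g (ρ g y) ∧ ρ b (ρ g (ρ g y)) = -ρ g (ρ g y) := by
  have rga : ∀ x, ρ b (ρ g x) = ρ g (ρ a x) := fun x => by
    rw [← Module.End.mul_apply, ← Module.End.mul_apply, ← map_mul, ← map_mul, h.ga]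
  have rgb : ∀ x, ρ a (ρ b (ρ g x)) = ρ g (ρ b x) := fun x => by
    rw [← Module.End.mul_apply, ← Module.End.mul_apply, ← Module.End.mul_apply, ← map_mul,
      ← map_mul, ← map_mul, h.gb, mul_assoc]
  have h1 : ρ b (ρ g y) = ρ g y := by rw [rga, hya]
  have h2 : ρ a (ρ g y) = -ρ g y := by
    have := rgb y
    rw [h1, hyb, map_neg] at this
    exact this
  have h3 : ρ b (ρ g (ρ g y)) = -ρ g (ρ g y) := by rw [rga, h2, map_neg]
  have h4 : ρ a (ρ g (ρ g y)) = -ρ g (ρ g y) := by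
    have := rgb (ρ g y)
    rw [h1, h3, map_neg] at this
    exact neg_eq_iff_eq_neg.1 this
  exact ⟨h2, h1, h4, h3⟩

theorem IsTetrahedral.linearIndependent {y : V} (hy : y ≠ 0) (hya : ρ a y = y)
    (hyb : ρ b y = -y) : LinearIndependent ℂ ![y, ρ g y, ρ g (ρ g y)] := by
  obtain ⟨h2, h1, h4, h3⟩ := h.apply_rotated ρ hya hyb
  have ginj : ∀ x, ρ g x = 0 → x = 0 := fun x hx => by
    have : ρ g⁻¹ (ρ g x) = x := by simp
    rw [← this, hx, map_zero]
  have hgy : ρ g y ≠ 0 := fun e => hy (ginj _ e)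
  have hggy : ρ g (ρ g y) ≠ 0 := fun e => hgy (ginj _ e)
  rw [Fintype.linearIndependent_iff]
  intro c hc
  simp only [Fin.sum_univ_three, Matrix.cons_val_zero, Matrix.cons_val_one, Matrix.cons_val] at hc
  have ea := congrArg (ρ a) hc
  have eb := congrArg (ρ b) hc
  simp only [map_add, map_smul, hya, hyb, h1, h2, h3, h4, smul_neg, map_zero] at ea eb
  have e0 : (2 * c 0) • y = 0 := by
    rw [mul_smul, two_smul]
    linear_combination (norm := module) hc + ea
  have e1 : (2 * c 1) • ρ g y = 0 := by
    rw [mul_smul, two_smul]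
    linear_combination (norm := module) hc + eb
  have c0 : c 0 = 0 := by simpa [hy] using e0
  have c1 : c 1 = 0 := by simpa [hgy] using e1
  have c2 : c 2 = 0 := by simpa [c0, c1, hggy] using hc
  intro i
  fin_cases i
  exacts [c0, c1, c2]

theorem IsTetrahedral.three_le_finrank [FiniteDimensional ℂ V] (ha : ρ a ≠ 1) :
    3 ≤ finrank ℂ V := by
  obtain ⟨y, hy, hya, hyb⟩ := h.exists_vector ρ ha
  simpa using (h.linearIndependent ρ hy hya hyb).fintype_card_le_finrank

theorem IsTetrahedral.exists_fixed (ha : ρ a ≠ 1) : ∃ p : V, p ≠ 0 ∧ ρ g p = p := by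
  obtain ⟨y, hy, hya, hyb⟩ := h.exists_vector ρ ha
  have hl := h.linearIndependent ρ hy hya hyb
  refine ⟨y + ρ g y + ρ g (ρ g y), fun h0 => ?_, ?_⟩
  · rw [Fintype.linearIndependent_iff] at hl
    have := hl ![1, 1, 1] (by simpa [Fin.sum_univ_three] using h0) 0
    simp at this
  · have : ρ g (ρ g (ρ g y)) = y := by
      rw [← Module.End.mul_apply, ← Module.End.mul_apply, ← map_mul, ← map_mul, h.ggg]
      simp
    simp only [map_add, this]
    abel

end Tetrahedral

/-! ### Explicit elements on six and on four points -/

section Points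

/-- The double transposition `(0 1)(2 3)` of six points. -/
def dblA : alternatingGroup (Fin 6) := ⟨swap 0 1 * swap 2 3, Perm.mem_alternatingGroup.2 (by decide)⟩

/-- The double transposition `(0 2)(1 3)` of six points. -/
def dblB : alternatingGroup (Fin 6) := ⟨swap 0 2 * swap 1 3, Perm.mem_alternatingGroup.2 (by decide)⟩

/-- The three-cycle `(1 2 3)` of six points. -/
def rotG : alternatingGroup (Fin 6) := ⟨swap 1 2 * swap 2 3, Perm.mem_alternatingGroup.2 (by decide)⟩

/-- The three-cycle `(0 1 2)` of six points. -/
def rotR : alternatingGroup (Fin 6) := ⟨swap 0 1 * swap 1 2, Perm.mem_alternatingGroup.2 (by decide)⟩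

/-- The three-cycle `(2 3 4)` of six points. -/
def rotT : alternatingGroup (Fin 6) := ⟨swap 2 3 * swap 3 4, Perm.mem_alternatingGroup.2 (by decide)⟩

/-- The double transposition `(0 1)(2 3)` of four points. -/
def dblA₄ : alternatingGroup (Fin 4) := ⟨swap 0 1 * swap 2 3, Perm.mem_alternatingGroup.2 (by decide)⟩

/-- The double transposition `(0 2)(1 3)` of four points. -/
def dblB₄ : alternatingGroup (Fin 4) := ⟨swap 0 2 * swap 1 3, Perm.mem_alternatingGroup.2 (by decide)⟩

/-- The three-cycle `(1 2 3)` of four points. -/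
def rotG₄ : alternatingGroup (Fin 4) := ⟨swap 1 2 * swap 2 3, Perm.mem_alternatingGroup.2 (by decide)⟩

theorem isTetrahedral_six : IsTetrahedral dblA dblB rotG := by
  constructor <;> decide

theorem isTetrahedral_four : IsTetrahedral dblA₄ dblB₄ rotG₄ := by
  constructor <;> decide

end Points

/-! ### Faithfulness from simplicity -/

section Simple

/-- The kernel is normal in a simple group. It is taken after lifting to the units of M, so that
endomorphism monoids are allowed as targets. -/
theorem injective_of_apply_ne_one {n : ℕ} (hn : 5 ≤ n) {M : Type*} [Monoid M]
    (φ : alternatingGroup (Fin n) →* M) {g : alternatingGroup (Fin n)} (hg : φ g ≠ 1)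
    {x y : alternatingGroup (Fin n)} (hxy : φ x = φ y) : x = y := by
  have : IsSimpleGroup (alternatingGroup (Fin n)) := alternatingGroup.isSimpleGroup (by simpa)
  rcases (MonoidHom.normal_ker φ.toHomUnits).eq_bot_or_eq_top with h | h
  · refine (MonoidHom.ker_eq_bot_iff _).1 h (Units.ext ?_)
    simpa using hxy
  · have h1 : g ∈ φ.toHomUnits.ker := by rw [h]; trivial
    exact absurd (by simpa using congrArg Units.val (MonoidHom.mem_ker.1 h1)) hg

end Simple

/-! ### Representations of A_6 of dimension at most three -/

section DimensionThree

variable {V : Type*} [AddCommGroup V] [Module ℂ V]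

/-- The equations add up to x + y + z = 1, and then every product of two unknowns vanishes. The
solutions are the coefficients of the elements 1, g, g² in the group algebra of a cyclic group of
order 3. -/
theorem coefficients_of_order_three {x y z : ℂ} (h1 : x ^ 2 + y ^ 2 + z ^ 2 = 1)
    (h2 : x * y + y * z + z * x = 0) (hx : x ^ 2 + 2 * y * z = x) (hy : z ^ 2 + 2 * x * y = z)
    (hz : y ^ 2 + 2 * x * z = y) :
    (x = 1 ∧ y = 0 ∧ z = 0) ∨ (x = 0 ∧ y = 1 ∧ z = 0) ∨ (x = 0 ∧ y = 0 ∧ z = 1) := by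
  have hs : x + y + z = 1 := by linear_combination -hx - hy - hz + h1 + 2 * h2
  have hyz : y * z = 0 := by
    have : 3 * (y * z) = 0 := by linear_combination hx + h2 - x * hs
    simpa using this
  have hxz : x * z = 0 := by
    have : 3 * (x * z) = 0 := by linear_combination hz + h2 - y * hs
    simpa using this
  have hxy : x * y = 0 := by linear_combination h2 - hyz - hxz
  rcases mul_eq_zero.1 hyz with h | h
  · rcases mul_eq_zero.1 hxz with h' | h'
    · right; right; refine ⟨h', h, ?_⟩; simpa [h, h'] using hs
    · left; refine ⟨?_, h, h'⟩; simpa [h, h'] using hs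
  · rcases mul_eq_zero.1 hxy with h' | h'
    · right; left; refine ⟨h', ?_, h⟩; simpa [h, h'] using hs
    · left; refine ⟨?_, h', h⟩; simpa [h, h'] using hs

/-- The three-cycle `(0 4 5)` of six points. -/
def rotH : alternatingGroup (Fin 6) := ⟨swap 0 4 * swap 4 5, Perm.mem_alternatingGroup.2 (by decide)⟩

/-- The double transposition `(1 2)(4 5)` of six points. -/
def dblK : alternatingGroup (Fin 6) := ⟨swap 1 2 * swap 4 5, Perm.mem_alternatingGroup.2 (by decide)⟩

/-- Otherwise V has the basis y, gy, g²y for g = (1 2 3). As h = (0 4 5) commutes with g, it is a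
polynomial in g. The involution (1 2)(4 5) inverts both g and h, so h⁻¹ = h² has the coefficients of
h with those of g and g² exchanged. Comparing with the square of h and with h · h⁻¹ = 1 leaves only
h = 1, g or g², against faithfulness. -/
theorem apply_dblA_eq_one_of_finrank_le_three [FiniteDimensional ℂ V]
    (ρ : Representation ℂ (alternatingGroup (Fin 6)) V) (hV : finrank ℂ V ≤ 3) :
    ρ dblA = 1 := by
  by_contra ha
  obtain ⟨y, hy, hya, hyb⟩ := isTetrahedral_six.exists_vector ρ ha
  have hl := isTetrahedral_six.linearIndependent ρ hy hya hyb
  have hcard : finrank ℂ V = 3 := le_antisymm hV (by simpa using hl.fintype_card_le_finrank)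
  have hspan := hl.span_eq_top_of_card_eq_finrank (by simp [hcard])
  have hgg : ρ rotG * ρ rotG * ρ rotG = 1 := by
    rw [← map_mul, ← map_mul, show rotG * rotG * rotG = 1 by decide, map_one]
  have hcomm : ρ rotH * ρ rotG = ρ rotG * ρ rotH := by
    rw [← map_mul, ← map_mul, show rotH * rotG = rotG * rotH by decide]
  -- The vector y generates V under g, so an operator commuting with g is determined by its value at
  -- y.
  have hext : ∀ S T : End ℂ V, S * ρ rotG = ρ rotG * S → T * ρ rotG = ρ rotG * T →
      S y = T y → S = T := by
    intro S T hS hT hST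
    have hS' : ∀ x, S (ρ rotG x) = ρ rotG (S x) := fun x => LinearMap.congr_fun hS x
    have hT' : ∀ x, T (ρ rotG x) = ρ rotG (T x) := fun x => LinearMap.congr_fun hT x
    refine LinearMap.ext_on_range hspan fun i => ?_
    fin_cases i <;> simp [hS', hT', hST]
  obtain ⟨c, hc⟩ : ∃ c : Fin 3 → ℂ, ∑ i, c i • (![y, ρ rotG y, ρ rotG (ρ rotG y)] i) =
      ρ rotH y := by
    rw [← Submodule.mem_span_range_iff_exists_fun, hspan]
    trivial
  have hform : ρ rotH = c 0 • 1 + c 1 • ρ rotG + c 2 • (ρ rotG * ρ rotG) := by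
    refine hext _ _ hcomm ?_ ?_
    · simp only [add_mul, mul_add, smul_mul_assoc, mul_smul_comm, one_mul, mul_one, mul_assoc]
    · rw [← hc]
      simp [Fin.sum_univ_three]
  have hcoef : ∀ x y z x' y' z' : ℂ, x • (1 : End ℂ V) + y • ρ rotG + z • (ρ rotG * ρ rotG) =
      x' • (1 : End ℂ V) + y' • ρ rotG + z' • (ρ rotG * ρ rotG) → x = x' ∧ y = y' ∧ z = z' := by
    intro p q r p' q' r' hE
    have h1 := LinearMap.congr_fun hE y
    rw [Fintype.linearIndependent_iff] at hl
    have h2 := hl ![p - p', q - q', r - r'] (by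
      simp only [Fin.sum_univ_three, Matrix.cons_val_zero, Matrix.cons_val_one, Matrix.cons_val,
        LinearMap.add_apply, LinearMap.smul_apply, Module.End.mul_apply, Module.End.one_apply]
        at h1 ⊢
      simp only [sub_smul]
      linear_combination (norm := module) h1)
    exact ⟨sub_eq_zero.1 (h2 0), sub_eq_zero.1 (h2 1), sub_eq_zero.1 (h2 2)⟩
  have hkk : ρ dblK * ρ dblK = 1 := by
    rw [← map_mul, show dblK * dblK = 1 by decide, map_one]
  have hinvG : ρ dblK * ρ rotG * ρ dblK = ρ rotG * ρ rotG := by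
    rw [← map_mul, ← map_mul, ← map_mul,
      show dblK * rotG * dblK = rotG * rotG by decide]
  have hinvH : ρ dblK * ρ rotH * ρ dblK = ρ rotH * ρ rotH := by
    rw [← map_mul, ← map_mul, ← map_mul,
      show dblK * rotH * dblK = rotH * rotH by decide]
  have hhh : ρ rotH * (ρ rotH * ρ rotH) = 1 := by
    rw [← map_mul, ← map_mul, show rotH * (rotH * rotH) = 1 by decide, map_one]
  have hg4 : ρ rotG * ρ rotG * (ρ rotG * ρ rotG) = ρ rotG := by
    rw [← mul_assoc, hgg, one_mul]
  have hinv : ρ rotH * ρ rotH = c 0 • 1 + c 2 • ρ rotG + c 1 • (ρ rotG * ρ rotG) := by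
    rw [← hinvH, hform]
    simp only [add_mul, mul_add, smul_mul_assoc, mul_smul_comm, mul_one, hkk, hinvG]
    have : ρ dblK * (ρ rotG * ρ rotG) * ρ dblK = ρ rotG := by
      calc _ = (ρ dblK * ρ rotG * ρ dblK) * (ρ dblK * ρ rotG * ρ dblK) := by
            rw [show (ρ dblK * ρ rotG * ρ dblK) * (ρ dblK * ρ rotG * ρ dblK) =
              ρ dblK * ρ rotG * (ρ dblK * ρ dblK) * ρ rotG * ρ dblK by noncomm_ring, hkk]
            noncomm_ring
        _ = ρ rotG := by rw [hinvG, hg4]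
    rw [this]
    abel
  set g := ρ rotG with hg
  have hsq : ρ rotH * ρ rotH = (c 0 ^ 2 + 2 * c 1 * c 2) • 1 + (c 2 ^ 2 + 2 * c 0 * c 1) • g +
      (c 1 ^ 2 + 2 * c 0 * c 2) • (g * g) := by
    rw [hform]
    simp only [add_mul, mul_add, smul_mul_assoc, mul_smul_comm, mul_one, one_mul, ← mul_assoc,
      hgg]
    module
  have hcube : ρ rotH * (ρ rotH * ρ rotH) = (c 0 ^ 2 + c 1 ^ 2 + c 2 ^ 2) • 1 +
      (c 0 * c 1 + c 1 * c 2 + c 2 * c 0) • g + (c 0 * c 1 + c 1 * c 2 + c 2 * c 0) • (g * g) := by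
    rw [hinv, hform]
    simp only [add_mul, mul_add, smul_mul_assoc, mul_smul_comm, mul_one, one_mul, ← mul_assoc,
      hgg]
    module
  obtain ⟨e0, e1, e2⟩ := hcoef _ _ _ _ _ _ (hsq.symm.trans hinv)
  obtain ⟨d0, d1, -⟩ := hcoef _ _ _ 1 0 0 ((hcube.symm.trans hhh).trans (by simp))
  have hinj : ∀ x : alternatingGroup (Fin 6), ρ rotH = ρ x → rotH = x := fun x =>
    injective_of_apply_ne_one (by norm_num) ρ ha
  rcases coefficients_of_order_three d0 d1 e0 e1 e2 with ⟨p, q, r⟩ | ⟨p, q, r⟩ | ⟨p, q, r⟩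
  · rw [p, q, r] at hform
    exact absurd (hinj 1 (by simpa using hform)) (by decide)
  · rw [p, q, r] at hform
    exact absurd (hinj rotG (by simpa using hform)) (by decide)
  · rw [p, q, r] at hform
    exact absurd (hinj (rotG * rotG) (by simpa using hform)) (by decide)

end DimensionThree

/-! ### Displacement spaces and stable subspaces -/

section Displacement

variable {G V : Type*} [Group G] [AddCommGroup V] [Module ℂ V] (ρ : Representation ℂ G V)

/-- The space of the vectors `ρ s x - x`. -/
def displacement (s : G) : Submodule ℂ V := LinearMap.range (ρ s - 1)

theorem apply_mem_displacement_conj (t : G) {s : G} {w : V} (hw : w ∈ displacement ρ s) :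
    ρ t w ∈ displacement ρ (t * s * t⁻¹) := by
  obtain ⟨x, rfl⟩ := hw
  exact ⟨ρ t x, by simp⟩

theorem displacement_conj_le_map (t s : G) :
    displacement ρ (t * s * t⁻¹) ≤ (displacement ρ s).map (ρ t) := by
  rintro _ ⟨x, rfl⟩
  exact ⟨ρ s (ρ t⁻¹ x) - ρ t⁻¹ x, ⟨ρ t⁻¹ x, rfl⟩, by simp⟩

theorem displacement_inv_le (s : G) : displacement ρ s⁻¹ ≤ displacement ρ s := by
  rintro _ ⟨x, rfl⟩
  exact ⟨-ρ s⁻¹ x, by simp; abel⟩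

theorem displacement_inv (s : G) : displacement ρ s⁻¹ = displacement ρ s :=
  le_antisymm (displacement_inv_le ρ s) (by simpa using displacement_inv_le ρ s⁻¹)

theorem finrank_displacement_conj_le [FiniteDimensional ℂ V] (t s : G) :
    finrank ℂ (displacement ρ (t * s * t⁻¹)) ≤ finrank ℂ (displacement ρ s) :=
  (Submodule.finrank_mono (displacement_conj_le_map ρ t s)).trans (Submodule.finrank_map_le _ _)

theorem apply_mem_of_displacement_le {s : G} {X : Submodule ℂ V} (h : displacement ρ s ≤ X) {x : V}
    (hx : x ∈ X) : ρ s x ∈ X := by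
  have : ρ s x = (ρ s x - x) + x := by abel
  rw [this]
  exact X.add_mem (h ⟨x, rfl⟩) hx

/-- The elements that map a subspace to itself together with their inverses. -/
def subspaceStabilizer (X : Submodule ℂ V) : Subgroup G where
  carrier := {s | (∀ x ∈ X, ρ s x ∈ X) ∧ ∀ x ∈ X, ρ s⁻¹ x ∈ X}
  mul_mem' := by
    rintro s t ⟨hs, hs'⟩ ⟨ht, ht'⟩
    refine ⟨fun x hx => ?_, fun x hx => ?_⟩
    · rw [map_mul]
      exact hs _ (ht _ hx)
    · rw [mul_inv_rev, map_mul]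
      exact ht' _ (hs' _ hx)
  one_mem' := by simp
  inv_mem' := by
    rintro s ⟨hs, hs'⟩
    exact ⟨hs', by simpa using hs⟩

theorem mem_subspaceStabilizer_of_displacement_le {s : G} {X : Submodule ℂ V}
    (h : displacement ρ s ≤ X) : s ∈ subspaceStabilizer ρ X :=
  ⟨fun _ hx => apply_mem_of_displacement_le ρ h hx,
    fun _ hx => apply_mem_of_displacement_le ρ ((displacement_inv ρ s).trans_le h) hx⟩

/-- The representation on a subspace that is mapped to itself. -/
def restrictTo (X : Submodule ℂ V) (hX : ∀ g, ∀ x ∈ X, ρ g x ∈ X) : Representation ℂ G X where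
  toFun g := (ρ g).restrict (hX g)
  map_one' := by ext; simp
  map_mul' x y := by ext; simp

theorem coe_restrictTo_apply (X : Submodule ℂ V) (hX : ∀ g, ∀ x ∈ X, ρ g x ∈ X) (g : G) (x : X) :
    (restrictTo ρ X hX g x : V) = ρ g x := rfl

end Displacement

/-! ### Three-cycles of A_6 with displacement of rank at most two -/

section SixPoints

variable {V : Type*} [AddCommGroup V] [Module ℂ V] [FiniteDimensional ℂ V]
  (ρ : Representation ℂ (alternatingGroup (Fin 6)) V)

theorem finrank_eq_two_of_linearIndependent {W : Submodule ℂ V} (hW : finrank ℂ W ≤ 2) {x y : V}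
    (hx : x ∈ W) (hy : y ∈ W) (h : LinearIndependent ℂ ![x, y]) : W = Submodule.span ℂ {x, y} := by
  have hr : Set.range ![x, y] = {x, y} := by simp [Set.pair_comm]
  have h2 : finrank ℂ (Submodule.span ℂ (Set.range ![x, y])) = 2 := by
    rw [finrank_span_eq_card h]; simp
  rw [hr] at h2
  refine (Submodule.eq_of_le_of_finrank_le ?_ (by rw [h2]; exact hW)).symm
  rw [Submodule.span_le]
  rintro z (rfl | rfl)
  exacts [hx, hy]

/-- Let t = (2 3 4) and v = gy + g²y. Conjugation by t permutes (0 1 2), (0 1 3), (0 1 4)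
cyclically, and v lies in the displacements of the first two. If v and tv were independent, the sum
X of these two displacements would contain the third, have dimension at most 3 and be stable under
A_6; but a acts on v by -1, against the triviality of a in dimension at most 3. So tv = cv, where c³
= 1 and c² = 1. -/
theorem apply_rotT_of_finrank_displacement_le (hr : finrank ℂ (displacement ρ rotR) ≤ 2) {y : V}
    (hy : y ≠ 0) (hya : ρ dblA y = y) (hyb : ρ dblB y = -y) :
    ρ rotT (ρ rotG y + ρ rotG (ρ rotG y)) = ρ rotG y + ρ rotG (ρ rotG y) := by
  obtain ⟨h1, -, h2, -⟩ := isTetrahedral_six.apply_rotated ρ hya hyb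
  have hl := isTetrahedral_six.linearIndependent ρ hy hya hyb
  set v := ρ rotG y + ρ rotG (ρ rotG y) with hv
  have hv0 : v ≠ 0 := by
    intro h0
    rw [Fintype.linearIndependent_iff] at hl
    have := hl ![0, 1, 1] (by simpa [Fin.sum_univ_three] using h0) 1
    simp at this
  have hav : ρ dblA v = -v := by rw [hv, map_add, h1, h2]; abel
  have hggg : ρ rotG (ρ rotG (ρ rotG y)) = y := by
    rw [← Module.End.mul_apply, ← Module.End.mul_apply, ← map_mul, ← map_mul,
      isTetrahedral_six.ggg]
    simp
  set x := y + ρ rotG y + ρ rotG (ρ rotG y) with hx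
  have hgx : ρ rotG x = x := by
    simp only [hx, map_add, hggg]
    abel
  -- Both (0 1 2) = ag² and (0 1 3) = ag act on the g-fixed vector x as a does, so this difference
  -- puts v into both displacements.
  have hax : ρ dblA x - x = (-2 : ℂ) • v := by
    simp only [hx, hv, map_add, hya, h1, h2]
    module
  have mem_of : ∀ s, ρ s x = ρ dblA x → v ∈ displacement ρ s := by
    intro s hs
    refine ⟨(-1 / 2 : ℂ) • x, ?_⟩
    have : (ρ s - 1) ((-1 / 2 : ℂ) • x) = (-1 / 2 : ℂ) • (ρ s x - x) := by simp
    rw [this, hs, hax, smul_smul]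
    norm_num
  let r' := rotT * rotR * rotT⁻¹
  let r'' := rotT * r' * rotT⁻¹
  have hr'' : rotT * r'' * rotT⁻¹ = rotR := by decide
  have hvr : v ∈ displacement ρ rotR := mem_of _ (by
    rw [show rotR = dblA * rotG * rotG by decide, map_mul, map_mul, Module.End.mul_apply,
      Module.End.mul_apply, hgx, hgx])
  have hvr' : v ∈ displacement ρ r' := mem_of _ (by
    rw [show r' = dblA * rotG by decide, map_mul, Module.End.mul_apply, hgx])
  have htr' : ρ rotT v ∈ displacement ρ r' := apply_mem_displacement_conj ρ _ hvr
  have htr'' : ρ rotT v ∈ displacement ρ r'' := apply_mem_displacement_conj ρ _ hvr'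
  have httr'' : ρ rotT (ρ rotT v) ∈ displacement ρ r'' := apply_mem_displacement_conj ρ _ htr'
  have httr : ρ rotT (ρ rotT v) ∈ displacement ρ rotR := by
    have := apply_mem_displacement_conj ρ rotT htr''
    rwa [hr''] at this
  have hd' : finrank ℂ (displacement ρ r') ≤ 2 := (finrank_displacement_conj_le ρ _ _).trans hr
  have hd'' : finrank ℂ (displacement ρ r'') ≤ 2 := (finrank_displacement_conj_le ρ _ _).trans hd'
  by_cases hli : LinearIndependent ℂ ![v, ρ rotT v]
  · exfalso
    have hli2 : LinearIndependent ℂ ![ρ rotT v, ρ rotT (ρ rotT v)] := by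
      rw [LinearIndependent.pair_iff] at hli ⊢
      intro p q hpq
      refine hli p q ?_
      have := congrArg (ρ rotT⁻¹) hpq
      simpa using this
    let X := displacement ρ rotR ⊔ displacement ρ r'
    have hX'' : displacement ρ r'' ≤ X := by
      rw [finrank_eq_two_of_linearIndependent hd'' htr'' httr'' hli2, Submodule.span_le]
      rintro z (rfl | rfl)
      · exact Submodule.mem_sup_right htr'
      · exact Submodule.mem_sup_left httr
    have hX3 : finrank ℂ X ≤ 3 := by
      have hinf : 1 ≤ finrank ℂ ↥(displacement ρ rotR ⊓ displacement ρ r') :=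
        Submodule.one_le_finrank_iff.2 fun h0 =>
          hv0 ((Submodule.eq_bot_iff _).1 h0 v ⟨hvr, hvr'⟩)
      have := Submodule.finrank_sup_add_finrank_inf_eq (displacement ρ rotR) (displacement ρ r')
      change finrank ℂ ↥(displacement ρ rotR ⊔ displacement ρ r') ≤ 3
      omega
    -- The involution (0 1)(4 5) inverts (0 1 2) and (0 1 3), hence preserves X. It sends (0 1 4) to
    -- the inverse of (0 1 5), the last three-cycle needed for generation.
    let u : alternatingGroup (Fin 6) :=
      ⟨swap 0 1 * swap 4 5, Perm.mem_alternatingGroup.2 (by decide)⟩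
    have huX : ∀ z ∈ X, ρ u z ∈ X := by
      intro z hz
      obtain ⟨p, hp, q, hq, rfl⟩ := Submodule.mem_sup.1 hz
      rw [map_add]
      refine X.add_mem (Submodule.mem_sup_left ?_) (Submodule.mem_sup_right ?_)
      · have := apply_mem_displacement_conj ρ u hp
        rwa [show u * rotR * u⁻¹ = rotR⁻¹ by decide, displacement_inv] at this
      · have := apply_mem_displacement_conj ρ u hq
        rwa [show u * r' * u⁻¹ = r'⁻¹ by decide, displacement_inv] at this
    have hX5 : displacement ρ (u * r'' * u⁻¹)⁻¹ ≤ X := by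
      rw [displacement_inv]
      refine (displacement_conj_le_map ρ _ _).trans ?_
      rintro _ ⟨z, hz, rfl⟩
      exact huX z (hX'' hz)
    have htop : subspaceStabilizer ρ X = ⊤ := by
      refine eq_top_of_threeCycles_mem (a := 0) (b := 1) (by decide) ?_
      intro g k hk0 hk1 hg
      have key : ∀ s : alternatingGroup (Fin 6), displacement ρ s ≤ X →
          (s : Perm (Fin 6)) = swap 0 1 * swap 1 k → g ∈ subspaceStabilizer ρ X := by
        intro s hs hsk
        rw [show g = s from Subtype.ext (hg.trans hsk.symm)]
        exact mem_subspaceStabilizer_of_displacement_le ρ hs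
      fin_cases k
      · exact absurd rfl hk0
      · exact absurd rfl hk1
      · exact key rotR le_sup_left rfl
      · exact key r' le_sup_right (by decide)
      · exact key r'' hX'' (by decide)
      · exact key _ hX5 (by decide)
    have hst : ∀ g, ∀ z ∈ X, ρ g z ∈ X := fun g => by
      have : g ∈ subspaceStabilizer ρ X := by rw [htop]; trivial
      exact this.1
    have h1 := apply_dblA_eq_one_of_finrank_le_three (restrictTo ρ X hst) hX3
    have h2 := congrArg Subtype.val
      (LinearMap.congr_fun h1 (⟨v, Submodule.mem_sup_left hvr⟩ : X))
    rw [coe_restrictTo_apply] at h2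
    change ρ dblA v = v at h2
    rw [hav, neg_eq_iff_add_eq_zero, ← two_smul ℂ] at h2
    exact hv0 ((smul_eq_zero.1 h2).resolve_left two_ne_zero)
  · rw [LinearIndependent.pair_iff' hv0] at hli
    push Not at hli
    obtain ⟨c, hc⟩ := hli
    have ht3 : ρ rotT (ρ rotT (ρ rotT v)) = v := by
      rw [← Module.End.mul_apply, ← Module.End.mul_apply, ← map_mul, ← map_mul,
        show rotT * rotT * rotT = 1 by decide]
      simp
    -- The relation t a t = a, applied to v, gives c² = 1.
    have hat : ρ rotT (ρ dblA (ρ rotT v)) = ρ dblA v := by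
      rw [← Module.End.mul_apply, ← Module.End.mul_apply, ← map_mul, ← map_mul,
        show rotT * dblA * rotT = dblA by decide]
    rw [← hc] at hat ht3
    simp only [map_smul, hav, ← hc, map_neg, smul_neg, smul_smul, neg_inj] at hat ht3
    have h1 : c * c = 1 := by
      have : (c * c - 1) • v = 0 := by rw [sub_smul, hat, one_smul, sub_self]
      simpa [hv0, sub_eq_zero] using this
    have h2 : c * c * c = 1 := by
      have : (c * c * c - 1) • v = 0 := by rw [sub_smul, ht3, one_smul, sub_self]
      simpa only [smul_eq_zero, hv0, or_false, sub_eq_zero] using this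
    have h3 : c = 1 := by rw [h1, one_mul] at h2; exact h2
    rw [← hc, h3, one_smul]

end SixPoints

/-! ### Eigenspaces of an operator of order three -/

section RootsOfUnity

theorem exists_cubic_root : ∃ ω : ℂ, ω ^ 2 + ω + 1 = 0 ∧ ω ≠ 1 := by
  obtain ⟨z, hz⟩ := IsAlgClosed.exists_pow_nat_eq (-3 : ℂ) (n := 2) (by norm_num)
  refine ⟨(-1 + z) / 2, by linear_combination hz / 4, fun h => ?_⟩
  have : z = 3 := by linear_combination 2 * h
  rw [this] at hz
  norm_num at hz

variable {V : Type*} [AddCommGroup V] [Module ℂ V]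

/-- Since c² = c⁻¹ and c = c⁻², the vector is three times the projection of x to the eigenspace. -/
theorem mem_eigenspace_projection {g : End ℂ V} (hg : g * g * g = 1) {c : ℂ} (hc : c ^ 3 = 1)
    (x : V) : x + c ^ 2 • g x + c • g (g x) ∈ End.eigenspace g c := by
  have h3 : g (g (g x)) = x := LinearMap.congr_fun hg x
  rw [End.mem_eigenspace_iff]
  simp only [map_add, map_smul, h3, smul_add, smul_smul]
  rw [show c * c ^ 2 = 1 by rw [← hc]; ring]
  module

theorem sum_eigenspace_projection (g : End ℂ V) {ω : ℂ} (hω : ω ^ 2 + ω + 1 = 0) (x : V) :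
    (3 : ℂ) • x = (x + g x + g (g x)) + (x + ω ^ 2 • g x + ω • g (g x)) +
      (x + (ω ^ 2) ^ 2 • g x + ω ^ 2 • g (g x)) := by
  have h4 : (ω ^ 2) ^ 2 = ω := by linear_combination (ω ^ 2 - ω) * hω
  have h2 : ω ^ 2 = -1 - ω := by linear_combination hω
  rw [h4, h2]
  module

end RootsOfUnity

/-! ### The rank of a three-cycle in a small representation -/

section Bound

universe u

variable {V : Type u} [AddCommGroup V] [Module ℂ V] [FiniteDimensional ℂ V]

/-- The displacement of r = (0 1 2) is the sum of the eigenspaces for ω and ω², which have equal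
dimension s. The copy of A_m on the other points commutes with r and acts on every eigenspace. If s
≥ 2, all three eigenspaces are so small that a double transposition of A_m acts trivially on each,
hence on V, against faithfulness. -/
theorem finrank_displacement_rotR_le {m : ℕ} (hm : 3 ≤ m)
    (ih : 6 ≤ m → ∀ (W : Type u) [AddCommGroup W] [Module ℂ W] [FiniteDimensional ℂ W]
      (ρ : Representation ℂ (alternatingGroup (Fin m)) W), finrank ℂ W + 2 ≤ m → ρ = 1)
    (ρ : Representation ℂ (alternatingGroup (Fin (m + 3))) V) (hV : finrank ℂ V + 2 ≤ m + 3)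
    (ι : Fin 6 ↪ Fin (m + 3)) (hι : ι = Fin.castLEEmb (by omega))
    (hρ : ρ (alternatingEmb ι dblA) ≠ 1) :
    finrank ℂ (displacement ρ (alternatingEmb ι rotR)) ≤ 2 := by
  obtain ⟨ω, hω, hω1⟩ := exists_cubic_root
  have hω3 : ω ^ 3 = 1 := by linear_combination (ω - 1) * hω
  have hω4 : (ω ^ 2) ^ 2 = ω := by linear_combination ω * hω3
  have hω6 : (ω ^ 2) ^ 3 = 1 := by linear_combination (ω ^ 3 + 1) * hω3
  have hω21 : ω ^ 2 ≠ 1 := fun h => hω1 (by linear_combination hω3 - ω * h)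
  have hω0 : ω ≠ 0 := fun h => by simp [h] at hω
  set r := alternatingEmb ι rotR with hr
  have hr3 : ρ r * ρ r * ρ r = 1 := by
    rw [← map_mul, ← map_mul, hr, ← map_mul, ← map_mul, show rotR * rotR * rotR = 1 by decide]
    simp
  set E : ℂ → Submodule ℂ V := fun c => End.eigenspace (ρ r) c with hE
  have hmem : ∀ c x, x ∈ E c ↔ ρ r x = c • x := fun c x => End.mem_eigenspace_iff
  -- the two nontrivial eigenvalues have the same multiplicity
  have hle : ∀ c, c ^ 3 = 1 → finrank ℂ (E c) ≤ finrank ℂ (E (c ^ 2)) := by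
    intro c hc
    -- The involution (0 1)(3 4) inverts r, so it maps the eigenspace of c into that of c⁻¹ = c².
    let k₀ : alternatingGroup (Fin 6) :=
      ⟨swap 0 1 * swap 3 4, Perm.mem_alternatingGroup.2 (by decide)⟩
    let k := alternatingEmb ι k₀
    have hk : ∀ x, ρ r (ρ k x) = ρ k (ρ r (ρ r x)) := by
      intro x
      simp only [← Module.End.mul_apply, ← map_mul, hr, k]
      rw [show rotR * k₀ = k₀ * (rotR * rotR) by decide]
    have hkk : ∀ x, ρ k (ρ k x) = x := by
      intro x
      simp only [← Module.End.mul_apply, ← map_mul, k]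
      rw [show k₀ * k₀ = 1 by decide]
      simp
    refine LinearMap.finrank_le_finrank_of_injective
      (f := (ρ k).restrict (p := E c) (q := E (c ^ 2)) ?_) ?_
    · intro x hx
      rw [hmem] at hx ⊢
      rw [hk, hx, map_smul, hx, map_smul, map_smul, smul_smul, sq]
    · intro x y hxy
      have := congrArg (fun z : E (c ^ 2) => ρ k z) hxy
      simpa [hkk] using this
  have hs : finrank ℂ (E (ω ^ 2)) = finrank ℂ (E ω) := by
    refine le_antisymm ?_ (hle ω hω3)
    have := hle (ω ^ 2) hω6
    rwa [hω4] at this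
  -- the displacement is the sum of the nontrivial eigenspaces
  have hdisp : displacement ρ r = E ω ⊔ E (ω ^ 2) := by
    apply le_antisymm
    · rintro _ ⟨x, rfl⟩
      have h1 := sum_eigenspace_projection (ρ r) hω ((ρ r - 1) x)
      have h0 : (ρ r - 1) x + ρ r ((ρ r - 1) x) + ρ r (ρ r ((ρ r - 1) x)) = 0 := by
        have h3 : ρ r (ρ r (ρ r x)) = x := LinearMap.congr_fun hr3 x
        simp only [LinearMap.sub_apply, Module.End.one_apply, map_sub, h3]
        abel
      rw [h0, zero_add] at h1
      have h2 : (3 : ℂ) • (ρ r - 1) x ∈ E ω ⊔ E (ω ^ 2) := by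
        rw [h1]
        exact Submodule.add_mem_sup (mem_eigenspace_projection hr3 hω3 _)
          (mem_eigenspace_projection hr3 hω6 _)
      exact (Submodule.smul_mem_iff _ (by norm_num)).1 h2
    · have key : ∀ c, c ≠ 1 → E c ≤ displacement ρ r := by
        intro c hc x hx
        rw [hmem] at hx
        refine ⟨(c - 1)⁻¹ • x, ?_⟩
        have hc' : c - 1 ≠ 0 := sub_ne_zero.2 hc
        have : (ρ r - 1) ((c - 1)⁻¹ • x) = (c - 1)⁻¹ • (c - 1) • x := by
          rw [map_smul, LinearMap.sub_apply, hx, Module.End.one_apply, sub_smul, one_smul]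
        rw [this, smul_smul, inv_mul_cancel₀ hc', one_smul]
      exact sup_le (key _ hω1) (key _ hω21)
  have hinf : E ω ⊓ E (ω ^ 2) = ⊥ := by
    rw [Submodule.eq_bot_iff]
    rintro x ⟨h1, h2⟩
    rw [SetLike.mem_coe, hmem] at h1 h2
    have : (ω - ω ^ 2) • x = 0 := by rw [sub_smul, ← h1, ← h2, sub_self]
    refine (smul_eq_zero.1 this).resolve_left fun h => hω1 ?_
    have : ω * (1 - ω) = 0 := by linear_combination h
    exact (sub_eq_zero.1 ((mul_eq_zero.1 this).resolve_left hω0)).symm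
  have hrank : finrank ℂ (displacement ρ r) = 2 * finrank ℂ (E ω) := by
    have := Submodule.finrank_sup_add_finrank_inf_eq (E ω) (E (ω ^ 2))
    rw [hinf, finrank_bot, hs, ← hdisp] at this
    omega
  -- there is a fixed vector
  have hker : LinearMap.ker (ρ r - 1) = E 1 := by
    ext x
    rw [hmem, LinearMap.mem_ker, LinearMap.sub_apply, Module.End.one_apply, one_smul, sub_eq_zero]
  have hfix : 1 ≤ finrank ℂ (E 1) := by
    obtain ⟨p, hp0, hp⟩ := (isTetrahedral_six.map (alternatingEmb ι)).exists_fixed ρ hρ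
    -- Conjugation by (0 3)(4 5) turns (1 2 3) into (0 1 2), so fixed vectors of the former go to
    -- fixed vectors of the latter. The factor (4 5) only makes the permutation even.
    let q₀ : alternatingGroup (Fin 6) :=
      ⟨swap 0 3 * swap 4 5, Perm.mem_alternatingGroup.2 (by decide)⟩
    refine Submodule.one_le_finrank_iff.2 fun h0 => hp0 ?_
    have hq : ρ (alternatingEmb ι q₀) p ∈ E 1 := by
      rw [hmem, ← Module.End.mul_apply, ← map_mul, hr, ← map_mul,
        show rotR * q₀ = q₀ * rotG by decide, map_mul, map_mul, Module.End.mul_apply, hp, one_smul]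
    rw [h0, Submodule.mem_bot] at hq
    have := congrArg (ρ (alternatingEmb ι q₀)⁻¹) hq
    simpa using this
  have htot : finrank ℂ (displacement ρ r) + finrank ℂ (E 1) = finrank ℂ V := by
    rw [← hker]
    exact LinearMap.finrank_range_add_finrank_ker _
  by_contra hlt
  -- From 2s + dim E 1 = dim V ≤ m + 1 and dim E 1 ≥ 1, failure of the bound gives s ≥ 2, m ≥ 4, dim
  -- E 1 ≤ m - 3 and 2s ≤ m.
  have hs2 : 2 ≤ finrank ℂ (E ω) := by omega
  have hm4 : 4 ≤ m := by omega
  let κ : Fin m ↪ Fin (m + 3) := Fin.addNatEmb 3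
  have hcomm : ∀ τ, r * alternatingEmb κ τ = alternatingEmb κ τ * r := by
    intro τ
    apply Subtype.ext
    refine Perm.Disjoint.commute (fun x => ?_)
    by_cases hx : 3 ≤ (x : ℕ)
    · left
      by_cases hx6 : ∃ y, ι y = x
      · obtain ⟨y, rfl⟩ := hx6
        rw [hr, alternatingEmb_apply]
        congr 1
        have hy : 3 ≤ (y : ℕ) := by rw [hι] at hx; exact hx
        clear hx
        revert y
        decide
      · rw [hr, alternatingEmb_apply_of_notMem]
        simpa using hx6
    · right
      refine alternatingEmb_apply_of_notMem _ _ fun y hy => hx ?_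
      rw [← hy]
      exact Nat.le_add_left 3 y
  have hstab : ∀ c τ, ∀ x ∈ E c, ρ (alternatingEmb κ τ) x ∈ E c := by
    intro c τ x hx
    rw [hmem] at hx ⊢
    rw [← Module.End.mul_apply, ← map_mul, hcomm, map_mul, Module.End.mul_apply, hx, map_smul]
  let ι₄ : Fin 4 ↪ Fin m := Fin.castLEEmb hm4
  -- For m ≥ 6 the induction hypothesis applies. For m = 4 and m = 5 the eigenspaces have dimension
  -- at most 2, below the bound 3 for A_4.
  have htriv : ∀ c, (finrank ℂ (E c) ≤ 2 ∨ 6 ≤ m ∧ finrank ℂ (E c) + 2 ≤ m) →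
      ∀ x ∈ E c, ρ (alternatingEmb κ (alternatingEmb ι₄ dblA₄)) x = x := by
    intro c hc x hx
    let θ : Representation ℂ (alternatingGroup (Fin m)) (E c) :=
      restrictTo (ρ.comp (alternatingEmb κ)) (E c) (hstab c)
    have hθ : θ (alternatingEmb ι₄ dblA₄) = 1 := by
      rcases hc with hc | ⟨h6, hc⟩
      · by_contra hne
        have := (isTetrahedral_four.map (alternatingEmb ι₄)).three_le_finrank θ hne
        omega
      · rw [ih h6 _ θ hc]
        rfl
    exact congrArg Subtype.val (LinearMap.congr_fun hθ (⟨x, hx⟩ : E c))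
  have hone : ρ (alternatingEmb κ (alternatingEmb ι₄ dblA₄)) = ρ 1 := by
    rw [map_one]
    ext x
    have h1 := sum_eigenspace_projection (ρ r) hω x
    have p1 := htriv 1 (by omega) _ (mem_eigenspace_projection hr3 (one_pow 3) x)
    have p2 := htriv ω (by omega) _ (mem_eigenspace_projection hr3 hω3 x)
    have p3 := htriv (ω ^ 2) (by omega) _ (mem_eigenspace_projection hr3 hω6 x)
    rw [one_pow, one_smul, one_smul] at p1
    have h2 := congrArg (ρ (alternatingEmb κ (alternatingEmb ι₄ dblA₄))) h1
    rw [map_add _ (_ + _), map_add _ (x + _ + _), p1, p2, p3, ← h1, map_smul] at h2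
    exact smul_right_injective V (by norm_num : (3 : ℂ) ≠ 0) h2
  have hid := injective_of_apply_ne_one (by omega) ρ hρ hone
  rw [← map_one (alternatingEmb κ)] at hid
  have hid2 := alternatingEmb_injective _ hid
  rw [← map_one (alternatingEmb ι₄)] at hid2
  exact absurd (alternatingEmb_injective _ hid2) (by decide)

end Bound

/-! ### Multiple transitivity of A_n -/

section Transitivity

theorem exists_alternating_extending {n : ℕ} (hn : 5 ≤ n) (x y : Fin 3 ↪ Fin n) :
    ∃ g : alternatingGroup (Fin n), ∀ i, (g : Perm (Fin n)) (x i) = y i := by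
  have := alternatingGroup.isMultiplyPretransitive (Fin n)
  have h3 : MulAction.IsMultiplyPretransitive (alternatingGroup (Fin n)) (Fin n) 3 :=
    MulAction.isMultiplyPretransitive_of_le (n := Nat.card (Fin n) - 2) (by simp; omega)
      (Nat.sub_le _ _)
  obtain ⟨g, hg⟩ := h3.exists_smul_eq x y
  exact ⟨g, fun i => DFunLike.congr_fun hg i⟩

theorem exists_alternating_apply_eq {n : ℕ} (hn : 5 ≤ n) {a b c a' b' c' : Fin n} (hab : a ≠ b)
    (hac : a ≠ c) (hbc : b ≠ c) (hab' : a' ≠ b') (hac' : a' ≠ c') (hbc' : b' ≠ c') :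
    ∃ g : alternatingGroup (Fin n), (g : Perm (Fin n)) a = a' ∧ (g : Perm (Fin n)) b = b' ∧
      (g : Perm (Fin n)) c = c' := by
  have emb : ∀ {a b c : Fin n}, a ≠ b → a ≠ c → b ≠ c → Function.Injective ![a, b, c] := by
    intro a b c hab hac hbc i j hij
    fin_cases i <;> fin_cases j <;> simp_all
  obtain ⟨g, hg⟩ := exists_alternating_extending hn ⟨_, emb hab hac hbc⟩ ⟨_, emb hab' hac' hbc'⟩
  exact ⟨g, hg 0, hg 1, hg 2⟩

theorem exists_alternating_apply_eq_pair {n : ℕ} (hn : 5 ≤ n) {a b a' b' : Fin n} (hab : a ≠ b)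
    (hab' : a' ≠ b') :
    ∃ g : alternatingGroup (Fin n), (g : Perm (Fin n)) a = a' ∧ (g : Perm (Fin n)) b = b' := by
  have third : ∀ a b : Fin n, ∃ c, c ≠ a ∧ c ≠ b := by
    intro a b
    obtain ⟨c, hc⟩ := Finset.exists_mem_notMem_of_card_lt_card (s := {a, b}) (t := univ)
      (by rw [Finset.card_fin]; exact lt_of_le_of_lt Finset.card_le_two (by omega))
    simp only [Finset.mem_insert, Finset.mem_singleton, not_or] at hc
    exact ⟨c, hc.2.1, hc.2.2⟩
  obtain ⟨c, hca, hcb⟩ := third a b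
  obtain ⟨c', hca', hcb'⟩ := third a' b'
  obtain ⟨g, h1, h2, -⟩ := exists_alternating_apply_eq hn hab hca.symm hcb.symm hab' hca'.symm
    hcb'.symm
  exact ⟨g, h1, h2⟩

end Transitivity

/-! ### Stable subspaces of the permutation module -/

section Permutation

/-- Move j, k to the points 0, 1. Subtracting the image under (0 1)(2 3) leaves multiples of e_0 -
e_1 and e_2 - e_3. Summing over the powers of (2 3 4) cancels the latter and triples the former;
double transitivity does the rest. -/
theorem single_sub_single_mem {n : ℕ} (hn : 6 ≤ n) (K : Submodule ℂ (Fin n → ℂ))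
    (hK : ∀ g : alternatingGroup (Fin n), ∀ c ∈ K, c ∘ (g : Perm (Fin n)) ∈ K) {c : Fin n → ℂ}
    (hc : c ∈ K) {j k : Fin n} (hjk : c j ≠ c k) (p q : Fin n) :
    Pi.single p 1 - Pi.single q 1 ∈ K := by
  rcases eq_or_ne p q with rfl | hpq
  · simp
  let ι : Fin 6 ↪ Fin n := Fin.castLEEmb hn
  have hjk' : j ≠ k := fun h => hjk (h ▸ rfl)
  obtain ⟨g, hg0, hg1⟩ := exists_alternating_apply_eq_pair (by omega)
    (ι.injective.ne (show (0 : Fin 6) ≠ 1 by decide)) hjk'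
  have hd := hK g c hc
  set d := c ∘ (g : Perm (Fin n)) with hd'
  have hd01 : d (ι 0) - d (ι 1) ≠ 0 := by
    simp only [hd', Function.comp_apply, hg0, hg1]
    exact sub_ne_zero.2 hjk
  let D := alternatingEmb ι dblA
  let t := alternatingEmb ι rotT
  let r := d - d ∘ (D : Perm (Fin n))
  have hr : r ∈ K := K.sub_mem hd (hK D d hd)
  have hrt := hK t r hr
  have hrtt := hK t _ hrt
  have hsum : r + r ∘ (t : Perm (Fin n)) + (r ∘ (t : Perm (Fin n))) ∘ (t : Perm (Fin n)) =
      (3 * (d (ι 0) - d (ι 1))) • (Pi.single (ι 0) 1 - Pi.single (ι 1) 1) := by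
    ext x
    by_cases hx : ∃ y, ι y = x
    · obtain ⟨y, rfl⟩ := hx
      simp only [r, Pi.add_apply, Pi.sub_apply, Function.comp_apply, D, t, alternatingEmb_apply,
        Pi.smul_apply, smul_eq_mul]
      have hs : ∀ z, (Pi.single (ι z) (1 : ℂ) : Fin n → ℂ) (ι y) = if y = z then 1 else 0 := by
        intro z
        simp [Pi.single_apply]
      rw [hs, hs]
      fin_cases y <;> simp [dblA, rotT, swap_apply_def] <;> ring
    · push Not at hx
      have h0 : ∀ z, (Pi.single (ι z) (1 : ℂ) : Fin n → ℂ) x = 0 := fun z =>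
        Pi.single_eq_of_ne (hx z).symm _
      simp [r, D, t, alternatingEmb_apply_of_notMem _ _ hx, h0]
  have h01 : Pi.single (ι 0) 1 - Pi.single (ι 1) 1 ∈ K := by
    have := K.add_mem (K.add_mem hr hrt) hrtt
    rw [hsum] at this
    exact (K.smul_mem_iff (mul_ne_zero (by norm_num) hd01)).1 this
  obtain ⟨s, hs0, hs1⟩ := exists_alternating_apply_eq_pair (by omega) hpq
    (ι.injective.ne (show (0 : Fin 6) ≠ 1 by decide))
  have := hK s _ h01
  convert this using 1
  ext x
  simp only [Pi.sub_apply, Function.comp_apply, Pi.single_apply, ← hs0, ← hs1,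
    EmbeddingLike.apply_eq_iff_eq]

end Permutation

/-! ### Vectors indexed by ordered pairs of points -/

section Pairs

variable {V : Type*} [AddCommGroup V] [Module ℂ V]

theorem coe_alternatingEmb_swap_mul_swap {k n : ℕ} (ι : Fin k ↪ Fin n)
    (σ : alternatingGroup (Fin k)) {a b c d : Fin k} (h : (σ : Perm (Fin k)) = swap a b * swap c d) :
    (alternatingEmb ι σ : Perm (Fin n)) = swap (ι a) (ι b) * swap (ι c) (ι d) := by
  ext1 x
  by_cases hx : ∃ y, ι y = x
  · obtain ⟨y, rfl⟩ := hx
    rw [alternatingEmb_apply, h]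
    simp only [Perm.mul_apply, ι.injective.swap_apply]
  · push Not at hx
    rw [alternatingEmb_apply_of_notMem _ _ hx, Perm.mul_apply,
      swap_apply_of_ne_of_ne (hx c).symm (hx d).symm, swap_apply_of_ne_of_ne (hx a).symm (hx b).symm]

/-- The vector is gy + g²y, with y from the A_4 on the points 0, 1, 2, 3. The three-cycles (2 3 k)
generate the alternating group on the points other than 0 and 1, and each of them fixes the vector
by `apply_rotT_of_finrank_displacement_le`. The two formulas for a say how the translates indexed by
pairs are related. -/
theorem exists_vector_fixed_by_pair_stabilizer [FiniteDimensional ℂ V] {m : ℕ} (hm : 4 ≤ m)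
    (ρ : Representation ℂ (alternatingGroup (Fin (m + 2))) V) (ι : Fin 6 ↪ Fin (m + 2))
    (hι : ι = Fin.castLEEmb (by omega)) (hρ : ρ (alternatingEmb ι dblA) ≠ 1)
    (hr : finrank ℂ (displacement ρ (alternatingEmb ι rotR)) ≤ 2) :
    ∃ v : V, v ≠ 0 ∧ ρ (alternatingEmb ι dblA) v = -v ∧
      ρ (alternatingEmb ι dblA) (ρ (alternatingEmb ι rotG) v) =
        ρ (alternatingEmb ι rotG) (ρ (alternatingEmb ι rotG) v) - v ∧
      ∀ g : alternatingGroup (Fin (m + 2)), (g : Perm (Fin (m + 2))) (ι 0) = ι 0 →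
        (g : Perm (Fin (m + 2))) (ι 1) = ι 1 → ρ g v = v := by
  have hT := isTetrahedral_six.map (alternatingEmb ι)
  obtain ⟨y, hy, hya, hyb⟩ := hT.exists_vector ρ hρ
  obtain ⟨h1, -, h2, -⟩ := hT.apply_rotated ρ hya hyb
  have hl := hT.linearIndependent ρ hy hya hyb
  have hggg : ρ (alternatingEmb ι rotG) (ρ (alternatingEmb ι rotG) (ρ (alternatingEmb ι rotG) y)) =
      y := by
    rw [← Module.End.mul_apply, ← Module.End.mul_apply, ← map_mul, ← map_mul, hT.ggg]
    simp
  refine ⟨ρ (alternatingEmb ι rotG) y + ρ (alternatingEmb ι rotG) (ρ (alternatingEmb ι rotG) y),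
    ?_, ?_, ?_, ?_⟩
  · intro h0
    rw [Fintype.linearIndependent_iff] at hl
    have := hl ![0, 1, 1] (by simpa [Fin.sum_univ_three] using h0) 1
    simp at this
  · rw [map_add, h1, h2]
    abel
  · simp only [map_add, hggg, h2, hya]
    abel
  set v := ρ (alternatingEmb ι rotG) y + ρ (alternatingEmb ι rotG) (ρ (alternatingEmb ι rotG) y)
    with hv
  -- the three-cycles through the third and the fourth point
  have hcyc : ∀ k, (∀ i : Fin 6, i < 4 → k ≠ ι i) → ∀ g : alternatingGroup (Fin (m + 2)),
      (g : Perm (Fin (m + 2))) = swap (ι 2) (ι 3) * swap (ι 3) k → ρ g v = v := by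
    intro k hk g hg
    -- The six points are changed so that k takes the place of the point 4. The elements a, b, g and
    -- (0 1 2) move only the points below 4 and stay the same.
    let κ : Fin 6 ↪ Fin (m + 2) := ι.trans (swap (ι 4) k).toEmbedding
    have hκ : ∀ i : Fin 6, i < 4 → ι i = κ i := by
      intro i hi
      refine (swap_apply_of_ne_of_ne ?_ (hk i hi).symm).symm
      exact ι.injective.ne (by rintro rfl; exact absurd hi (by decide))
    have hκ4 : κ 4 = k := swap_apply_left _ _
    have hcongr : ∀ σ : alternatingGroup (Fin 6), (∀ x : Fin 6, x < 4 ∨ (σ : Perm (Fin 6)) x = x) →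
        alternatingEmb ι σ = alternatingEmb κ σ := by
      intro σ hσ
      refine alternatingEmb_congr σ (fun x => (hσ x).imp_left (hκ x)) fun x => ?_
      rcases hσ ((σ : Perm (Fin 6)) x) with h | h
      · exact Or.inr (hκ _ h)
      · exact Or.inl ((σ : Perm (Fin 6)).injective h)
    have hG := hcongr rotG (by decide)
    have := apply_rotT_of_finrank_displacement_le (ρ.comp (alternatingEmb κ)) (y := y)
      (by
        change finrank ℂ (displacement ρ (alternatingEmb κ rotR)) ≤ 2
        rw [← hcongr rotR (by decide)]
        exact hr) hy
      (by
        change ρ (alternatingEmb κ dblA) y = y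
        rw [← hcongr dblA (by decide), hya])
      (by
        change ρ (alternatingEmb κ dblB) y = -y
        rw [← hcongr dblB (by decide), hyb])
    simp only [MonoidHom.comp_apply, ← hG] at this
    rw [← hv] at this
    rw [show g = alternatingEmb κ rotT from Subtype.ext ?_]
    · exact this
    · rw [hg, coe_alternatingEmb_swap_mul_swap κ rotT rfl, hκ4, hκ 2 (by decide), hκ 3 (by decide)]
  let κ : Fin m ↪ Fin (m + 2) := Fin.addNatEmb 2
  let S : Subgroup (alternatingGroup (Fin m)) :=
    { carrier := {s | ρ (alternatingEmb κ s) v = v}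
      mul_mem' := by
        intro s t hs ht
        simp only [Set.mem_ofPred_eq, map_mul, Module.End.mul_apply] at *
        rw [ht, hs]
      one_mem' := by simp
      inv_mem' := by
        intro s hs
        simp only [Set.mem_ofPred_eq] at *
        have := congrArg (ρ (alternatingEmb κ s)⁻¹) hs
        simp only [Representation.inv_self_apply] at this
        rw [map_inv]
        exact this.symm }
  have hκ : ∀ x : Fin m, (κ x : ℕ) = x + 2 := fun x => rfl
  have hιv : ∀ x : Fin 6, (ι x : ℕ) = x := fun x => by rw [hι]; rfl
  have hS : S = ⊤ := by
    refine eq_top_of_threeCycles_mem (a := ⟨0, by omega⟩) (b := ⟨1, by omega⟩) (by simp) ?_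
    intro g k hk0 hk1 hg
    refine hcyc (κ k) ?_ _ ?_
    · intro i hi h
      have h' := congrArg Fin.val h
      rw [hκ, hιv] at h'
      have h0 : (k : ℕ) ≠ 0 := fun e => hk0 (Fin.ext e)
      have h1 : (k : ℕ) ≠ 1 := fun e => hk1 (Fin.ext e)
      have : (i : ℕ) < 4 := hi
      omega
    · rw [coe_alternatingEmb_swap_mul_swap κ g hg]
      have e2 : κ ⟨0, by omega⟩ = ι 2 := Fin.ext (by rw [hκ, hιv]; rfl)
      have e3 : κ ⟨1, by omega⟩ = ι 3 := Fin.ext (by rw [hκ, hιv]; rfl)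
      rw [e2, e3]
  intro g hg0 hg1
  obtain ⟨s, rfl⟩ := mem_range_alternatingEmb κ (g := g) (by
    intro x hx
    have hx2 : (x : ℕ) < 2 := by
      by_contra hx2
      exact hx ⟨x - 2, by omega⟩ (Fin.ext (by rw [hκ]; simp only; omega))
    rcases (by omega : (x : ℕ) = 0 ∨ (x : ℕ) = 1) with h | h
    · rw [show x = ι 0 from Fin.ext (by rw [h, hιv]; rfl), hg0]
    · rw [show x = ι 1 from Fin.ext (by rw [h, hιv]; rfl), hg1])
  have : s ∈ S := by rw [hS]; trivial
  exact this

/-- The translates F i j of v are antisymmetric and satisfy F j k = F i k - F i j, so F i j = u j -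
u i for suitable vectors u j. A linear relation among the u j with coefficient sum 0 would, by
`single_sub_single_mem`, yield u 1 = u 0, that is v = 0. -/
theorem le_finrank_add_one_of_vector [FiniteDimensional ℂ V] {n : ℕ} (hn : 6 ≤ n)
    (ρ : Representation ℂ (alternatingGroup (Fin n)) V) (ι : Fin 6 ↪ Fin n) {v : V} (hv : v ≠ 0)
    (hav : ρ (alternatingEmb ι dblA) v = -v)
    (hagv : ρ (alternatingEmb ι dblA) (ρ (alternatingEmb ι rotG) v) =
        ρ (alternatingEmb ι rotG) (ρ (alternatingEmb ι rotG) v) - v)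
    (hfix : ∀ g : alternatingGroup (Fin n), (g : Perm (Fin n)) (ι 0) = ι 0 →
        (g : Perm (Fin n)) (ι 1) = ι 1 → ρ g v = v) :
    n ≤ finrank ℂ V + 1 := by
  classical
  have hι : ∀ {i j : Fin 6}, i ≠ j → ι i ≠ ι j := fun h => ι.injective.ne h
  -- By `hfix` the translate depends only on the images of the two points. The default 0 occurs only
  -- on the diagonal, which is never used.
  obtain ⟨F, hF⟩ : ∃ F : Fin n → Fin n → V, ∀ σ : alternatingGroup (Fin n),
      F ((σ : Perm (Fin n)) (ι 0)) ((σ : Perm (Fin n)) (ι 1)) = ρ σ v := by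
    refine ⟨fun i j => if h : ∃ σ : alternatingGroup (Fin n), (σ : Perm (Fin n)) (ι 0) = i ∧
      (σ : Perm (Fin n)) (ι 1) = j then ρ h.choose v else 0, fun σ => ?_⟩
    have h : ∃ τ : alternatingGroup (Fin n), (τ : Perm (Fin n)) (ι 0) = (σ : Perm (Fin n)) (ι 0) ∧
      (τ : Perm (Fin n)) (ι 1) = (σ : Perm (Fin n)) (ι 1) := ⟨σ, rfl, rfl⟩
    simp only [dif_pos h]
    obtain ⟨h0, h1⟩ := h.choose_spec
    have hfx := hfix (σ⁻¹ * h.choose) (by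
      rw [Subgroup.coe_mul, Perm.mul_apply, h0]; simp) (by
      rw [Subgroup.coe_mul, Perm.mul_apply, h1]; simp)
    have := congrArg (ρ σ) hfx
    rwa [map_mul, Module.End.mul_apply, Representation.self_inv_apply] at this
  have hFg : ∀ (g : alternatingGroup (Fin n)) (i j : Fin n), i ≠ j →
      ρ g (F i j) = F ((g : Perm (Fin n)) i) ((g : Perm (Fin n)) j) := by
    intro g i j hij
    obtain ⟨σ, rfl, rfl⟩ := exists_alternating_apply_eq_pair (by omega)
      (hι (show (0 : Fin 6) ≠ 1 by decide)) hij
    have := hF (g * σ)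
    rw [Subgroup.coe_mul, Perm.mul_apply, Perm.mul_apply, map_mul, Module.End.mul_apply] at this
    rw [this, hF]
  have hF01 : F (ι 0) (ι 1) = v := by simpa using hF 1
  have hF10 : F (ι 1) (ι 0) = -F (ι 0) (ι 1) := by
    have := hFg (alternatingEmb ι dblA) _ _ (hι (show (0 : Fin 6) ≠ 1 by decide))
    rw [hF01, hav, alternatingEmb_apply, alternatingEmb_apply] at this
    rw [hF01, this]
    congr 1
  have hF02 : ρ (alternatingEmb ι rotG) v = F (ι 0) (ι 2) := by
    have := hFg (alternatingEmb ι rotG) _ _ (hι (show (0 : Fin 6) ≠ 1 by decide))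
    rw [hF01, alternatingEmb_apply, alternatingEmb_apply] at this
    exact this
  have hF03 : ρ (alternatingEmb ι rotG) (F (ι 0) (ι 2)) = F (ι 0) (ι 3) := by
    have := hFg (alternatingEmb ι rotG) _ _ (hι (show (0 : Fin 6) ≠ 2 by decide))
    rw [alternatingEmb_apply, alternatingEmb_apply] at this
    exact this
  have hF13 : F (ι 1) (ι 3) = F (ι 0) (ι 3) - F (ι 0) (ι 1) := by
    have := hFg (alternatingEmb ι dblA) _ _ (hι (show (0 : Fin 6) ≠ 2 by decide))
    rw [← hF02, hagv, hF02, hF03, alternatingEmb_apply, alternatingEmb_apply] at this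
    rw [hF01, this]
    congr 1
  have hneg : ∀ i j, i ≠ j → F j i = -F i j := by
    intro i j hij
    obtain ⟨σ, rfl, rfl⟩ := exists_alternating_apply_eq_pair (by omega)
      (hι (show (0 : Fin 6) ≠ 1 by decide)) hij
    rw [← hFg _ _ _ (hι (by decide)), ← hFg _ _ _ (hι (by decide)), hF10, map_neg]
  have hsub : ∀ i j k, i ≠ j → i ≠ k → j ≠ k → F j k = F i k - F i j := by
    intro i j k hij hik hjk
    obtain ⟨σ, rfl, rfl, rfl⟩ := exists_alternating_apply_eq (by omega)
      (hι (show (0 : Fin 6) ≠ 1 by decide)) (hι (show (0 : Fin 6) ≠ 3 by decide))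
      (hι (show (1 : Fin 6) ≠ 3 by decide)) hij hik hjk
    rw [← hFg _ _ _ (hι (by decide)), ← hFg _ _ _ (hι (by decide)), ← hFg _ _ _ (hι (by decide)),
      hF13, map_sub]
  let u : Fin n → V := fun j => if j = ι 0 then 0 else F (ι 0) j
  have hu0 : u (ι 0) = 0 := if_pos rfl
  have hu : ∀ j, j ≠ ι 0 → u j = F (ι 0) j := fun j hj => if_neg hj
  have hFu : ∀ i j, i ≠ j → F i j = u j - u i := by
    intro i j hij
    by_cases hi : i = ι 0
    · subst hi
      rw [hu0, hu j hij.symm, sub_zero]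
    · by_cases hj : j = ι 0
      · subst hj
        rw [hu0, hu i hi, zero_sub, hneg _ _ hij.symm]
      · rw [hu i hi, hu j hj, hsub (ι 0) i j (Ne.symm hi) (Ne.symm hj) hij]
  have hgu : ∀ (g : alternatingGroup (Fin n)) j,
      ρ g (u j) = u ((g : Perm (Fin n)) j) - u ((g : Perm (Fin n)) (ι 0)) := by
    intro g j
    by_cases hj : j = ι 0
    · subst hj
      rw [hu0, map_zero, sub_self]
    · rw [hu j hj, hFg _ _ _ (Ne.symm hj), hFu _ _ ((g : Perm (Fin n)).injective.ne (Ne.symm hj))]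
  -- The group permutes the u j only up to a common shift. The coordinate sum is included so that
  -- this shift cancels on the kernel, which is therefore stable.
  let L : (Fin n → ℂ) →ₗ[ℂ] ℂ × V :=
    (∑ j, LinearMap.proj j).prod (∑ j, (LinearMap.proj j).smulRight (u j))
  have hL : ∀ c, L c = (∑ j, c j, ∑ j, c j • u j) := by
    intro c
    simp [L, LinearMap.prod_apply]
  have hker : ∀ c, c ∈ LinearMap.ker L ↔ ∑ j, c j = 0 ∧ ∑ j, c j • u j = 0 := by
    intro c
    rw [LinearMap.mem_ker, hL, Prod.mk_eq_zero]
  have hstab : ∀ g : alternatingGroup (Fin n), ∀ c ∈ LinearMap.ker L,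
      c ∘ (g : Perm (Fin n)) ∈ LinearMap.ker L := by
    intro g c hc
    rw [hker] at hc ⊢
    have hs : ∑ j, (c ∘ (g : Perm (Fin n))) j = 0 := by
      rw [← hc.1]
      exact Equiv.sum_comp (g : Perm (Fin n)) c
    refine ⟨hs, ?_⟩
    have : ρ g (∑ j, (c ∘ (g : Perm (Fin n))) j • u j) = 0 := by
      rw [map_sum]
      simp only [map_smul, hgu, smul_sub, Finset.sum_sub_distrib, ← Finset.sum_smul, hs, zero_smul,
        sub_zero]
      rw [← hc.2]
      exact Equiv.sum_comp (g : Perm (Fin n)) fun j => c j • u j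
    have h2 := congrArg (ρ g⁻¹) this
    simpa using h2
  have hbot : LinearMap.ker L = ⊥ := by
    rw [Submodule.eq_bot_iff]
    intro c hc
    have hconst : ∀ j k, c j = c k := by
      by_contra hne
      push Not at hne
      obtain ⟨j, k, hjk⟩ := hne
      have := single_sub_single_mem hn (LinearMap.ker L) hstab hc hjk (ι 1) (ι 0)
      rw [hker] at this
      have h2 := this.2
      simp only [Pi.sub_apply, sub_smul, Finset.sum_sub_distrib, Pi.single_apply, ite_smul,
        one_smul, zero_smul, Finset.sum_ite_eq', Finset.mem_univ, if_true] at h2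
      rw [hu0, sub_zero, hu _ (hι (by decide)), hF01] at h2
      exact hv h2
    have h1 := ((hker c).1 hc).1
    ext j
    rw [Finset.sum_congr rfl fun k _ => hconst k j] at h1
    have hn0 : n ≠ 0 := by omega
    simpa [hn0] using h1
  have := LinearMap.finrank_le_finrank_of_injective (LinearMap.ker_eq_bot.1 hbot)
  simpa [add_comm] using this

end Pairs

/-! ### Representations of dimension at most n - 2 are trivial -/

section Bound

universe u

theorem rep_eq_one_of_finrank_lt (n : ℕ) (hn : 6 ≤ n) (V : Type u) [AddCommGroup V] [Module ℂ V]
    [FiniteDimensional ℂ V] (ρ : Representation ℂ (alternatingGroup (Fin n)) V)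
    (hV : finrank ℂ V + 2 ≤ n) : ρ = 1 := by
  induction n using Nat.strong_induction_on generalizing V with
  | _ n ih =>
    by_contra hne
    -- Three points are split off for a three-cycle, with which A_m on the remaining points
    -- commutes.
    obtain ⟨m, rfl⟩ : ∃ m, n = m + 3 := ⟨n - 3, by omega⟩
    obtain ⟨g, hg⟩ : ∃ g, ρ g ≠ 1 := by
      by_contra h
      push Not at h
      exact hne (MonoidHom.ext h)
    let ι : Fin 6 ↪ Fin (m + 3) := Fin.castLEEmb hn
    have hρ : ρ (alternatingEmb ι dblA) ≠ 1 := by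
      intro h
      have h1 := injective_of_apply_ne_one (by omega) ρ hg (h.trans (map_one ρ).symm)
      rw [← map_one (alternatingEmb ι)] at h1
      exact absurd (alternatingEmb_injective ι h1) (by decide)
    have hr := finrank_displacement_rotR_le (by omega)
      (fun h6 W _ _ _ θ hθ => ih m (by omega) h6 W θ hθ) ρ hV ι rfl hρ
    obtain ⟨v, hv, hav, hagv, hfix⟩ :=
      exists_vector_fixed_by_pair_stabilizer (m := m + 1) (by omega) ρ ι rfl hρ hr
    have := le_finrank_add_one_of_vector hn ρ ι hv hav hagv hfix
    omega

end Bound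

/-! ### The standard representation of dimension n - 1 -/

section Standard

/-- The permutation representation of the alternating group. -/
noncomputable def permRep (n : ℕ) : Representation ℂ (alternatingGroup (Fin n)) (Fin n → ℂ) where
  toFun g := LinearMap.funLeft ℂ ℂ ((g⁻¹ : alternatingGroup (Fin n)) : Perm (Fin n))
  map_one' := by ext; simp
  map_mul' x y := by
    ext c j
    simp [LinearMap.funLeft_apply]

theorem permRep_apply {n : ℕ} (g : alternatingGroup (Fin n)) (c : Fin n → ℂ) :
    permRep n g c = c ∘ ((g⁻¹ : alternatingGroup (Fin n)) : Perm (Fin n)) := rfl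

/-- The vectors with coordinate sum zero. -/
noncomputable def sumZero (n : ℕ) : Submodule ℂ (Fin n → ℂ) :=
  LinearMap.ker (∑ j, LinearMap.proj j : (Fin n → ℂ) →ₗ[ℂ] ℂ)

theorem mem_sumZero {n : ℕ} {c : Fin n → ℂ} : c ∈ sumZero n ↔ ∑ j, c j = 0 := by
  simp [sumZero, LinearMap.mem_ker]

theorem finrank_sumZero {n : ℕ} (hn : 1 ≤ n) : finrank ℂ (sumZero n) = n - 1 := by
  have h := LinearMap.finrank_range_add_finrank_ker
    (∑ j, LinearMap.proj j : (Fin n → ℂ) →ₗ[ℂ] ℂ)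
  have hr : LinearMap.range (∑ j, LinearMap.proj j : (Fin n → ℂ) →ₗ[ℂ] ℂ) = ⊤ := by
    rw [LinearMap.range_eq_top]
    intro z
    exact ⟨Pi.single ⟨0, hn⟩ z, by simp⟩
  rw [hr, finrank_top, finrank_self, finrank_fin_fun] at h
  change 1 + finrank ℂ (sumZero n) = n at h
  omega

theorem permRep_mem_sumZero {n : ℕ} (g : alternatingGroup (Fin n)) (c : Fin n → ℂ)
    (hc : c ∈ sumZero n) : permRep n g c ∈ sumZero n := by
  rw [mem_sumZero] at *
  rw [← hc, permRep_apply]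
  exact Equiv.sum_comp _ c

/-- A nonzero vector with sum zero is not constant, so K contains all differences of basis vectors,
and these span. -/
theorem sumZero_le_of_stable {n : ℕ} (hn : 6 ≤ n) (K : Submodule ℂ (Fin n → ℂ))
    (hK : ∀ g, ∀ c ∈ K, permRep n g c ∈ K) {c : Fin n → ℂ} (hc : c ∈ K) (hc0 : c ∈ sumZero n)
    (hne : c ≠ 0) : sumZero n ≤ K := by
  have hK' : ∀ g : alternatingGroup (Fin n), ∀ c ∈ K, c ∘ (g : Perm (Fin n)) ∈ K := by
    intro g c hc
    have := hK g⁻¹ c hc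
    rwa [permRep_apply, inv_inv] at this
  obtain ⟨j, k, hjk⟩ : ∃ j k, c j ≠ c k := by
    by_contra hcon
    push Not at hcon
    refine hne (funext fun j => ?_)
    have h1 := mem_sumZero.1 hc0
    rw [Finset.sum_congr rfl fun k _ => hcon k j] at h1
    have hn0 : n ≠ 0 := by omega
    simpa [hn0] using h1
  intro d hd
  have hd' : d = ∑ j, d j • (Pi.single j 1 - Pi.single ⟨0, by omega⟩ 1) := by
    simp only [smul_sub, Finset.sum_sub_distrib, ← Finset.sum_smul, mem_sumZero.1 hd, zero_smul,
      sub_zero]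
    ext x
    simp [Finset.sum_apply, Pi.single_apply]
  rw [hd']
  exact K.sum_mem fun j _ => K.smul_mem _ (single_sub_single_mem hn K hK' hc hjk _ _)

theorem mem_nontrivialIrrepDims {n : ℕ} (hn : 6 ≤ n) :
    n - 1 ∈ nontrivialIrrepDims (alternatingGroup (Fin n)) := by
  let θ := restrictTo (permRep n) (sumZero n) permRep_mem_sumZero
  let e : sumZero n ≃ₗ[ℂ] (Fin (n - 1) → ℂ) := LinearEquiv.ofFinrankEq _ _ (by
    rw [finrank_sumZero (by omega), finrank_fin_fun])
  let ρ : Representation ℂ (alternatingGroup (Fin n)) (Fin (n - 1) → ℂ) :=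
    { toFun := fun g => e.conj (θ g)
      map_one' := by ext; simp
      map_mul' := fun x y => by ext; simp [LinearEquiv.conj_apply] }
  have hρ : ∀ g w, ρ g w = e (θ g (e.symm w)) := fun g w => rfl
  refine ⟨ρ, ?_, ?_⟩
  · have hnt : Nontrivial (Subrepresentation ρ) := by
      refine ⟨⊥, ⊤, fun h => ?_⟩
      have h1 := congrArg Subrepresentation.toSubmodule h
      have : Nontrivial (Fin (n - 1) → ℂ) := by
        have : Nonempty (Fin (n - 1)) := ⟨⟨0, by omega⟩⟩
        infer_instance
      exact bot_ne_top (α := Submodule ℂ (Fin (n - 1) → ℂ)) h1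
    refine { eq_bot_or_eq_top := fun N => ?_ }
    by_cases hN : N.toSubmodule = ⊥
    · exact Or.inl (Subrepresentation.toSubmodule_injective hN)
    · right
      apply Subrepresentation.toSubmodule_injective
      obtain ⟨w, hw, hw0⟩ := Submodule.exists_mem_ne_zero_of_ne_bot hN
      let K : Submodule ℂ (Fin n → ℂ) := (N.toSubmodule.comap (e : sumZero n →ₗ[ℂ] _)).map
        (sumZero n).subtype
      have hK : ∀ g, ∀ c ∈ K, permRep n g c ∈ K := by
        rintro g _ ⟨c, hc, rfl⟩
        refine ⟨θ g c, ?_, rfl⟩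
        have := N.apply_mem_toSubmodule g hc
        rw [LinearEquiv.coe_coe, hρ, LinearEquiv.symm_apply_apply] at this
        exact this
      have hle := sumZero_le_of_stable hn K hK (c := e.symm w)
        ⟨e.symm w, by simpa using hw, rfl⟩ (e.symm w).2 (by simpa using hw0)
      change N.toSubmodule = ⊤
      rw [eq_top_iff]
      intro x _
      obtain ⟨c, hc, hcx⟩ := hle (e.symm x).2
      have : c = e.symm x := Subtype.ext hcx
      rw [this] at hc
      simpa using hc
  · intro h1
    let ι : Fin 6 ↪ Fin n := Fin.castLEEmb hn
    have h2 : θ (alternatingEmb ι dblA) = 1 := by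
      have := congrArg (fun r : Representation ℂ (alternatingGroup (Fin n)) (Fin (n - 1) → ℂ) =>
        r (alternatingEmb ι dblA)) h1
      exact e.conj.injective (this.trans (by ext; simp))
    let c : Fin n → ℂ := Pi.single (ι 0) 1 - Pi.single (ι 2) 1
    have hc : c ∈ sumZero n := by rw [mem_sumZero]; simp [c]
    have h3 := congrArg Subtype.val (LinearMap.congr_fun h2 ⟨c, hc⟩)
    have h4 := congrFun h3 (ι 0)
    change c ((((alternatingEmb ι dblA)⁻¹ : alternatingGroup (Fin n)) : Perm (Fin n)) (ι 0)) =
      c (ι 0) at h4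
    rw [← map_inv, alternatingEmb_apply] at h4
    have h5 : ((dblA⁻¹ : alternatingGroup (Fin 6)) : Perm (Fin 6)) 0 = 1 := by decide
    rw [h5] at h4
    simp [c] at h4

end Standard

theorem isLeast_nontrivialIrrepDims {n : ℕ} (hn : 6 ≤ n) :
    IsLeast (nontrivialIrrepDims (alternatingGroup (Fin n))) (n - 1) := by
  refine ⟨mem_nontrivialIrrepDims hn, ?_⟩
  rintro d ⟨ρ, -, hρ⟩
  by_contra hd
  exact hρ (rep_eq_one_of_finrank_lt n hn _ ρ (by rw [finrank_fin_fun]; omega))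

/-! ### The agreement probability as a trilinear sum -/

section Bias

variable {G : Type*}

/-- The value `1` or `-1` of `f` at `x`, as a real number. -/
def realSign (f : G → ℤˣ) (x : G) : ℝ := ((f x : ℤˣ) : ℤ)

theorem realSign_mul_self (f : G → ℤˣ) (x : G) : realSign f x * realSign f x = 1 := by
  unfold realSign
  rw [← Int.cast_mul, ← Units.val_mul, Int.units_mul_self]
  simp

theorem norm_realSign_sq (f : G → ℤˣ) (x : G) : ‖(realSign f x : ℂ)‖ ^ 2 = 1 := by
  rw [Complex.norm_real, Real.norm_eq_abs, sq_abs, sq, realSign_mul_self]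

variable [Group G] [Fintype G]

/-- The sum of `f x * f y * f (x * y)` over all pairs. -/
def biasSum (f : G → ℤˣ) : ℝ := ∑ x, ∑ y, realSign f x * realSign f y * realSign f (x * y)

/-- For signs, the indicator of f(x)f(y) = f(xy) is (1 + f(x)f(y)f(xy))/2. -/
theorem homProb_eq (f : G → ℤˣ) :
    homProb f = 1 / 2 * (1 + biasSum f / (Fintype.card G : ℝ) ^ 2) := by
  have hG : (Fintype.card G : ℝ) ≠ 0 := by exact_mod_cast Fintype.card_ne_zero
  have key : ((univ.filter fun p : G × G => f p.1 * f p.2 = f (p.1 * p.2)).card : ℝ) =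
      ∑ p : G × G, (1 / 2 * (1 + realSign f p.1 * realSign f p.2 * realSign f (p.1 * p.2))) := by
    rw [Finset.card_filter, Nat.cast_sum]
    refine Finset.sum_congr rfl fun p _ => ?_
    unfold realSign
    rcases Int.units_eq_one_or (f p.1) with h1 | h1 <;>
      rcases Int.units_eq_one_or (f p.2) with h2 | h2 <;>
      rcases Int.units_eq_one_or (f (p.1 * p.2)) with h3 | h3 <;> simp [h1, h2, h3] <;> norm_num
  unfold homProb
  rw [key, ← Finset.mul_sum, Finset.sum_add_distrib, Fintype.sum_prod_type, Fintype.sum_prod_type,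
    Fintype.card_prod, Nat.cast_mul]
  simp only [Finset.sum_const, Finset.card_univ, nsmul_eq_mul, mul_one]
  unfold biasSum
  field_simp

theorem isZeroMean_iff {G : Type*} [Nonempty G] [Fintype G] (f : G → ℤˣ) : IsZeroMean f ↔ ∑ x, realSign f x = 0 := by
  have hG : (Fintype.card G : ℝ) ≠ 0 := by exact_mod_cast Fintype.card_ne_zero
  unfold IsZeroMean
  rw [Fintype.expect_eq_sum_div_card, div_eq_zero_iff, or_iff_left hG]
  rfl

end Bias

/-! ### The convolution operator and the upper bound -/

section Convolution

variable {G : Type} [Group G] [Fintype G]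

/-- The operator `u ↦ (x ↦ ∑ z, f (x⁻¹ * z) * u z)`. -/
noncomputable def convOp (f : G → ℤˣ) : EuclideanSpace ℂ G →L[ℂ] EuclideanSpace ℂ G :=
  LinearMap.toContinuousLinearMap
    { toFun := fun u => WithLp.toLp 2 fun x => ∑ z, (realSign f (x⁻¹ * z) : ℂ) * u z
      map_add' := fun u w => by
        ext x
        simp [mul_add, Finset.sum_add_distrib]
      map_smul' := fun c u => by
        ext x
        simp only [PiLp.smul_apply, smul_eq_mul, RingHom.id_apply, Finset.mul_sum]
        exact Finset.sum_congr rfl fun z _ => by ring }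

theorem convOp_apply (f : G → ℤˣ) (u : EuclideanSpace ℂ G) (x : G) :
    convOp f u x = ∑ z, (realSign f (x⁻¹ * z) : ℂ) * u z := rfl

/-- The translation representation on the functions on `G`. -/
noncomputable def translation (g : G) : EuclideanSpace ℂ G ≃ₗᵢ[ℂ] EuclideanSpace ℂ G :=
  LinearIsometryEquiv.piLpCongrLeft 2 ℂ ℂ (Equiv.mulLeft g)

theorem translation_apply (g : G) (u : EuclideanSpace ℂ G) (x : G) :
    translation g u x = u (g⁻¹ * x) := rfl

theorem convOp_translation (f : G → ℤˣ) (g : G) (u : EuclideanSpace ℂ G) :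
    convOp f (translation g u) = translation g (convOp f u) := by
  ext x
  rw [translation_apply, convOp_apply, convOp_apply, ← Equiv.sum_comp (Equiv.mulLeft g)]
  refine Finset.sum_congr rfl fun z _ => ?_
  simp [translation_apply, mul_assoc]

/-- The translation representation of a finite group. -/
noncomputable def translationRep (G : Type) [Group G] [Fintype G] :
    Representation ℂ G (EuclideanSpace ℂ G) where
  toFun g := (translation g).toLinearEquiv.toLinearMap
  map_one' := by
    ext u x
    simp [translation_apply]
  map_mul' a b := by
    ext u x
    simp [translation_apply, mul_assoc]

theorem translationRep_apply (g : G) (u : EuclideanSpace ℂ G) :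
    translationRep G g u = translation g u := rfl

open scoped InnerProductSpace

theorem inner_translation (g : G) (z w : EuclideanSpace ℂ G) :
    ⟪z, translation g w⟫_ℂ = ⟪translation g⁻¹ z, w⟫_ℂ := by
  rw [← (translation g).inner_map_map (translation g⁻¹ z) w]
  congr 1
  ext x
  simp [translation_apply]

/-- The singular space of an operator for its greatest singular value. -/
def topSpace {H : Type*} [NormedAddCommGroup H] [InnerProductSpace ℂ H] (T : H →L[ℂ] H) :
    Submodule ℂ H where
  carrier := {w | ∀ z, ⟪T z, T w⟫_ℂ = ((‖T‖ ^ 2 : ℝ) : ℂ) * ⟪z, w⟫_ℂ}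
  add_mem' := by
    intro a b ha hb z
    rw [map_add, inner_add_right, inner_add_right, ha, hb, mul_add]
  zero_mem' := by simp
  smul_mem' := by
    intro c a ha z
    rw [map_smul, inner_smul_right, inner_smul_right, ha]
    ring

/-- Take a unit vector u at which ‖Tu‖ attains ‖T‖. Expanding gives ‖T*Tu - ‖T‖²u‖² ≤ ‖T‖⁴ - 2‖T‖⁴ +
‖T‖⁴ = 0, so u is an eigenvector of T*T. -/
theorem exists_mem_topSpace {H : Type*} [NormedAddCommGroup H] [InnerProductSpace ℂ H]
    [FiniteDimensional ℂ H] [Nontrivial H] (T : H →L[ℂ] H) : ∃ u ∈ topSpace T, u ≠ 0 := by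
  have : ProperSpace H := FiniteDimensional.proper ℂ H
  obtain ⟨u, hu, hmax⟩ := (isCompact_sphere (0 : H) 1).exists_isMaxOn
    (NormedSpace.sphere_nonempty.2 zero_le_one) (T.continuous.norm.continuousOn)
  have hu1 : ‖u‖ = 1 := by simpa using hu
  have hTu : ‖T u‖ = ‖T‖ := by
    refine le_antisymm ((T.le_opNorm u).trans (by rw [hu1, mul_one])) ?_
    refine T.opNorm_le_of_unit_norm (norm_nonneg _) fun x hx => hmax (by simpa using hx)
  refine ⟨u, fun z => ?_, fun h => by simp [h] at hu1⟩
  have : CompleteSpace H := FiniteDimensional.complete ℂ H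
  have hzero : T.adjoint (T u) - ((‖T‖ ^ 2 : ℝ) : ℂ) • u = 0 := by
    rw [← norm_le_zero_iff]
    have h1 := norm_sub_sq (𝕜 := ℂ) (T.adjoint (T u)) (((‖T‖ ^ 2 : ℝ) : ℂ) • u)
    have h2 : RCLike.re ⟪T.adjoint (T u), ((‖T‖ ^ 2 : ℝ) : ℂ) • u⟫_ℂ = ‖T‖ ^ 2 * ‖T‖ ^ 2 := by
      rw [inner_smul_right, ContinuousLinearMap.adjoint_inner_left, inner_self_eq_norm_sq_to_K, hTu]
      norm_cast
      change Complex.re (((‖T‖ ^ 2 : ℝ) : ℂ) * ((‖T‖ ^ 2 : ℝ) : ℂ)) = _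
      rw [← Complex.ofReal_mul, Complex.ofReal_re]
    have h3 : ‖((‖T‖ ^ 2 : ℝ) : ℂ) • u‖ = ‖T‖ ^ 2 := by
      rw [norm_smul, hu1, mul_one, Complex.norm_real, Real.norm_of_nonneg (by positivity)]
    have h4 : ‖T.adjoint (T u)‖ ≤ ‖T‖ ^ 2 := by
      refine (T.adjoint.le_opNorm _).trans ?_
      rw [LinearIsometryEquiv.norm_map, hTu, sq]
    have h5 : ‖T.adjoint (T u)‖ ^ 2 ≤ (‖T‖ ^ 2) ^ 2 := by gcongr
    rw [h2, h3] at h1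
    have h6 : ‖T.adjoint (T u) - ((‖T‖ ^ 2 : ℝ) : ℂ) • u‖ ^ 2 ≤ 0 := by rw [h1]; nlinarith
    nlinarith [norm_nonneg (T.adjoint (T u) - ((‖T‖ ^ 2 : ℝ) : ℂ) • u)]
  rw [← ContinuousLinearMap.adjoint_inner_right, sub_eq_zero.1 hzero, inner_smul_right]

/-- The Hilbert–Schmidt norm of the operator is |G|, since all |G|² matrix entries are ±1. On an
orthonormal basis of the top space each image has norm ‖T‖; Bessel's inequality for each row r x
bounds the total. -/
theorem finrank_topSpace_mul_le (f : G → ℤˣ) :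
    (finrank ℂ (topSpace (convOp f)) : ℝ) * ‖convOp f‖ ^ 2 ≤ (Fintype.card G : ℝ) ^ 2 := by
  let b := stdOrthonormalBasis ℂ (topSpace (convOp f))
  have hb : Orthonormal ℂ fun i => (b i : EuclideanSpace ℂ G) :=
    b.orthonormal.comp_linearIsometry (topSpace (convOp f)).subtypeₗᵢ
  let r : G → EuclideanSpace ℂ G := fun x => WithLp.toLp 2 fun z => (realSign f (x⁻¹ * z) : ℂ)
  have hr : ∀ x u, convOp f u x = ⟪r x, u⟫_ℂ := by
    intro x u
    rw [convOp_apply, PiLp.inner_apply]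
    refine Finset.sum_congr rfl fun z _ => ?_
    simp [r, mul_comm]
  have hrn : ∀ x, ‖r x‖ ^ 2 = Fintype.card G := by
    intro x
    rw [EuclideanSpace.norm_sq_eq]
    have : ∀ z, ‖r x z‖ ^ 2 = 1 := by
      exact fun z => norm_realSign_sq f _
    simp [this]
  have hTb : ∀ i, ‖convOp f (b i)‖ ^ 2 = ‖convOp f‖ ^ 2 := by
    intro i
    have h1 := (b i).2 (b i)
    rw [inner_self_eq_norm_sq_to_K, inner_self_eq_norm_sq_to_K, hb.1 i] at h1
    norm_num at h1
    exact_mod_cast h1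
  calc (finrank ℂ (topSpace (convOp f)) : ℝ) * ‖convOp f‖ ^ 2
      = ∑ i, ‖convOp f (b i)‖ ^ 2 := by simp [hTb]
    _ = ∑ x, ∑ i, ‖⟪r x, (b i : EuclideanSpace ℂ G)⟫_ℂ‖ ^ 2 := by
        rw [Finset.sum_comm]
        refine Finset.sum_congr rfl fun i _ => ?_
        rw [EuclideanSpace.norm_sq_eq]
        exact Finset.sum_congr rfl fun x _ => by rw [hr]
    _ ≤ ∑ x : G, (Fintype.card G : ℝ) := by
        refine Finset.sum_le_sum fun x _ => ?_
        rw [← hrn x]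
        have := hb.sum_inner_products_le (r x) (s := univ)
        refine le_trans (le_of_eq ?_) this
        exact Finset.sum_congr rfl fun i _ => by rw [norm_inner_symm]
    _ = (Fintype.card G : ℝ) ^ 2 := by simp [sq]

/-- The top singular space is stable under translations. With dimension below D it would consist of
constants, which T kills because f has mean zero, so T would vanish. Hence D‖T‖² ≤ |G|², and ⟨F, TF⟩
is at most ‖T‖|G|. -/
theorem homProb_le_of_rep_eq_one {D : ℕ} (hD : 1 ≤ D)
    (h : ∀ (W : Type) [AddCommGroup W] [Module ℂ W] [FiniteDimensional ℂ W]
      (ρ : Representation ℂ G W), finrank ℂ W < D → ρ = 1)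
    (f : G → ℤˣ) (hf : IsZeroMean f) : homProb f ≤ 1 / 2 * (1 + 1 / √(D : ℝ)) := by
  have hG : (0 : ℝ) < Fintype.card G := by exact_mod_cast Fintype.card_pos
  have hD' : (0 : ℝ) < D := by exact_mod_cast hD
  rw [isZeroMean_iff] at hf
  let T := convOp f
  have hnorm : ‖T‖ ≤ Fintype.card G / √(D : ℝ) := by
    by_cases hT : ‖T‖ = 0
    · rw [hT]; positivity
    have hdim : D ≤ finrank ℂ (topSpace T) := by
      by_contra hlt
      have hstab : ∀ g, ∀ w ∈ topSpace T, translationRep G g w ∈ topSpace T := by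
        intro g w hw z
        rw [translationRep_apply, convOp_translation, inner_translation, ← convOp_translation,
          hw, inner_translation]
      have htriv := h _ (restrictTo (translationRep G) (topSpace T) hstab) (not_le.1 hlt)
      obtain ⟨u, hu, hu0⟩ := exists_mem_topSpace T
      have hfix : ∀ g, translation g u = u := fun g =>
        congrArg Subtype.val (LinearMap.congr_fun
          (DFunLike.congr_fun htriv g) (⟨u, hu⟩ : topSpace T))
      have hconst : ∀ x, u x = u 1 := by
        intro x
        have := congrArg (fun w : EuclideanSpace ℂ G => w x) (hfix x)
        simp only [translation_apply, inv_mul_cancel] at this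
        exact this.symm
      have hTu : T u = 0 := by
        ext x
        rw [convOp_apply]
        simp only [hconst]
        have hs : ∑ z, (realSign f (x⁻¹ * z) : ℂ) = ∑ z, (realSign f z : ℂ) :=
          Equiv.sum_comp (Equiv.mulLeft x⁻¹) fun y => (realSign f y : ℂ)
        rw [← Finset.sum_mul, hs, ← Complex.ofReal_sum, hf]
        simp
      have h1 := hu u
      rw [hTu, inner_zero_left] at h1
      rcases mul_eq_zero.1 h1.symm with h2 | h2
      · exact hT (pow_eq_zero_iff (two_ne_zero)|>.1 (by exact_mod_cast h2))
      · exact hu0 (inner_self_eq_zero.1 h2)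
    have h1 := finrank_topSpace_mul_le f
    have h2 : (D : ℝ) * ‖T‖ ^ 2 ≤ (Fintype.card G : ℝ) ^ 2 :=
      le_trans (by gcongr) h1
    rw [le_div_iff₀ (Real.sqrt_pos.2 hD')]
    refine le_of_sq_le_sq ?_ hG.le
    rw [mul_pow, Real.sq_sqrt hD'.le]
    linarith
  let F : EuclideanSpace ℂ G := WithLp.toLp 2 fun x => (realSign f x : ℂ)
  have hF : ‖F‖ ^ 2 = Fintype.card G := by
    rw [EuclideanSpace.norm_sq_eq]
    have : ∀ z, ‖F z‖ ^ 2 = 1 := by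
      exact fun z => norm_realSign_sq f _
    simp [this]
  have hS : ((biasSum f : ℝ) : ℂ) = ⟪F, T F⟫_ℂ := by
    rw [PiLp.inner_apply, biasSum, Complex.ofReal_sum]
    refine Finset.sum_congr rfl fun x _ => ?_
    have hT : T F x = ∑ y, (realSign f y : ℂ) * (realSign f (x * y) : ℂ) := by
      change ∑ z, (realSign f (x⁻¹ * z) : ℂ) * (realSign f z : ℂ) = _
      rw [← Equiv.sum_comp (Equiv.mulLeft x)]
      simp
    rw [hT]
    simp only [F, RCLike.inner_apply, Complex.conj_ofReal,
      Complex.ofReal_sum, Complex.ofReal_mul, Finset.sum_mul]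
    exact Finset.sum_congr rfl fun y _ => by ring
  have hle : biasSum f ≤ (Fintype.card G : ℝ) ^ 2 / √(D : ℝ) := by
    calc biasSum f ≤ ‖((biasSum f : ℝ) : ℂ)‖ := by
          rw [Complex.norm_real]; exact Real.le_norm_self _
      _ ≤ ‖F‖ * (‖T‖ * ‖F‖) := by
          rw [hS]
          exact (norm_inner_le_norm _ _).trans (by gcongr; exact T.le_opNorm F)
      _ = ‖T‖ * ‖F‖ ^ 2 := by ring
      _ ≤ Fintype.card G / √(D : ℝ) * Fintype.card G := by rw [hF]; gcongr
      _ = _ := by ring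
  rw [homProb_eq]
  have : biasSum f / (Fintype.card G : ℝ) ^ 2 ≤ 1 / √(D : ℝ) := by
    rw [div_le_iff₀ (by positivity)]
    calc _ ≤ _ := hle
      _ = _ := by ring
  linarith

end Convolution

theorem homProb_alternatingGroup_le {n : ℕ} (hn : 6 ≤ n) (f : alternatingGroup (Fin n) → ℤˣ)
    (hf : IsZeroMean f) : homProb f ≤ 1 / 2 * (1 + 1 / √((n : ℝ) - 1)) := by
  have := homProb_le_of_rep_eq_one (D := n - 1) (by omega)
    (fun W _ _ _ ρ hW => rep_eq_one_of_finrank_lt n hn W ρ (by omega)) f hf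
  rwa [Nat.cast_sub (by omega), Nat.cast_one] at this

/-! ### Random signs on cosets and the lower bound -/

section Averaging

/-- A sign as a real number. -/
def signVal (u : ℤˣ) : ℝ := ((u : ℤ) : ℝ)

theorem signVal_mul (u v : ℤˣ) : signVal (u * v) = signVal u * signVal v := by
  simp [signVal]

theorem signVal_neg_one : signVal (-1) = -1 := by simp [signVal]

theorem signVal_one : signVal 1 = 1 := by simp [signVal]

theorem signVal_mul_self (u : ℤˣ) : signVal u * signVal u = 1 := by
  rw [← signVal_mul, Int.units_mul_self, signVal_one]

/-- If the four points do not match in pairs, some t occurs an odd number of times among them, and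
flipping ε t changes the sign of the sum. -/
theorem sum_signs_eq {Q : Type*} [Fintype Q] [DecidableEq Q] (o p q r : Q)
    [Decidable (p = o ∧ q = r ∨ q = o ∧ p = r ∨ r = o ∧ p = q)] :
    ∑ ε : Q → ℤˣ, signVal (ε p * ε q * ε r * ε o) =
      if p = o ∧ q = r ∨ q = o ∧ p = r ∨ r = o ∧ p = q then
        (Fintype.card (Q → ℤˣ) : ℝ) else 0 := by
  split_ifs with h
  · have : ∀ ε : Q → ℤˣ, signVal (ε p * ε q * ε r * ε o) = 1 := by
      intro ε
      rcases h with ⟨rfl, rfl⟩ | ⟨rfl, rfl⟩ | ⟨rfl, rfl⟩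
      · rw [mul_assoc (ε p), Int.units_mul_self, mul_one, Int.units_mul_self, signVal_one]
      · rw [mul_assoc, mul_comm (ε p) (ε q), Int.units_mul_self, signVal_one]
      · rw [Int.units_mul_self, one_mul, Int.units_mul_self, signVal_one]
    simp [this]
  · obtain ⟨t, ht⟩ : ∃ t : Q, (Pi.mulSingle t (-1 : ℤˣ) : Q → ℤˣ) p *
        (Pi.mulSingle t (-1 : ℤˣ) : Q → ℤˣ) q * (Pi.mulSingle t (-1 : ℤˣ) : Q → ℤˣ) r *
        (Pi.mulSingle t (-1 : ℤˣ) : Q → ℤˣ) o = -1 := by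
      simp only [Pi.mulSingle_apply]
      push Not at h
      by_cases hp : p = o
      · refine ⟨r, ?_⟩
        subst hp
        by_cases hpr : p = r <;> simp [h.1 rfl, hpr]
      · by_cases hq : q = o
        · refine ⟨r, ?_⟩
          subst hq
          by_cases hqr : q = r <;> simp [h.2.1 rfl, hqr]
        · by_cases hr : r = o
          · refine ⟨p, ?_⟩
            subst hr
            simp [Ne.symm (h.2.2 rfl), Ne.symm hp]
          · exact ⟨o, by simp [hp, hq, hr]⟩
    have h1 := Equiv.sum_comp (Equiv.mulLeft (Pi.mulSingle t (-1 : ℤˣ) : Q → ℤˣ))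
      fun ε : Q → ℤˣ => signVal (ε p * ε q * ε r * ε o)
    have h2 : ∀ ε : Q → ℤˣ, signVal
        ((Equiv.mulLeft (Pi.mulSingle t (-1 : ℤˣ) : Q → ℤˣ) ε) p *
          (Equiv.mulLeft (Pi.mulSingle t (-1 : ℤˣ) : Q → ℤˣ) ε) q *
          (Equiv.mulLeft (Pi.mulSingle t (-1 : ℤˣ) : Q → ℤˣ) ε) r *
          (Equiv.mulLeft (Pi.mulSingle t (-1 : ℤˣ) : Q → ℤˣ) ε) o) =
        -signVal (ε p * ε q * ε r * ε o) := by
      intro ε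
      have hprod : ∀ a b c d w x y z : ℤˣ,
          a * w * (b * x) * (c * y) * (d * z) = a * b * c * d * (w * x * y * z) := by
        intro a b c d w x y z
        rw [mul_mul_mul_comm a, mul_mul_mul_comm (a * b), mul_mul_mul_comm (a * b * c)]
      simp only [Equiv.coe_mulLeft, Pi.mul_apply]
      rw [hprod, ht, signVal_mul (-1), signVal_neg_one, neg_one_mul]
    simp only [h2, Finset.sum_neg_distrib] at h1
    linarith

variable {G : Type*} [Group G] (H : Subgroup G) (χ : H →* ℤˣ)

open Classical in
/-- The extension by zero of a real character of a subgroup. -/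
noncomputable def extendZero (x : G) : ℝ := if h : x ∈ H then signVal (χ ⟨x, h⟩) else 0

variable {H}

theorem extendZero_of_mem {x : G} (h : x ∈ H) : extendZero H χ x = signVal (χ ⟨x, h⟩) := dif_pos h

theorem extendZero_of_notMem {x : G} (h : x ∉ H) : extendZero H χ x = 0 := dif_neg h

theorem extendZero_mul_left {x : G} (h : x ∈ H) (y : G) :
    extendZero H χ (x * y) = extendZero H χ x * extendZero H χ y := by
  by_cases hy : y ∈ H
  · rw [extendZero_of_mem χ h, extendZero_of_mem χ hy, extendZero_of_mem χ (H.mul_mem h hy),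
      ← signVal_mul, ← map_mul]
    rfl
  · rw [extendZero_of_notMem χ hy, mul_zero, extendZero_of_notMem]
    rwa [H.mul_mem_cancel_left h]

theorem extendZero_mul_self {x : G} (h : x ∈ H) : extendZero H χ x * extendZero H χ x = 1 := by
  rw [extendZero_of_mem χ h, signVal_mul_self]

variable [Fintype G]

/-- This is the sum of a real character over H ∩ yHy⁻¹. If a term at some a is negative, it equals
-1, and translating by a shows that the sum is its own negative. -/
theorem sum_extendZero_conj_nonneg (y : G) :
    0 ≤ ∑ x, extendZero H χ x * extendZero H χ (y⁻¹ * x * y) := by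
  by_cases h : ∀ x, 0 ≤ extendZero H χ x * extendZero H χ (y⁻¹ * x * y)
  · exact Finset.sum_nonneg fun x _ => h x
  · push Not at h
    obtain ⟨a, ha⟩ := h
    have ha1 : a ∈ H := by
      by_contra hn
      rw [extendZero_of_notMem χ hn, zero_mul] at ha
      exact lt_irrefl _ ha
    have ha2 : y⁻¹ * a * y ∈ H := by
      by_contra hn
      rw [extendZero_of_notMem χ hn, mul_zero] at ha
      exact lt_irrefl _ ha
    have hsq : (extendZero H χ a * extendZero H χ (y⁻¹ * a * y)) *
        (extendZero H χ a * extendZero H χ (y⁻¹ * a * y)) = 1 := by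
      rw [mul_mul_mul_comm, extendZero_mul_self χ ha1, extendZero_mul_self χ ha2, one_mul]
    have hm1 : extendZero H χ a * extendZero H χ (y⁻¹ * a * y) = -1 := by
      rcases mul_self_eq_one_iff.1 hsq with h | h
      · rw [h] at ha; norm_num at ha
      · exact h
    have h1 := Equiv.sum_comp (Equiv.mulLeft a)
      fun x => extendZero H χ x * extendZero H χ (y⁻¹ * x * y)
    have h2 : ∀ x, extendZero H χ (a * x) * extendZero H χ (y⁻¹ * (a * x) * y) =
        -(extendZero H χ x * extendZero H χ (y⁻¹ * x * y)) := by
      intro x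
      rw [show y⁻¹ * (a * x) * y = (y⁻¹ * a * y) * (y⁻¹ * x * y) by group,
        extendZero_mul_left χ ha1, extendZero_mul_left χ ha2, mul_mul_mul_comm, hm1, neg_one_mul]
    simp only [Equiv.coe_mulLeft, h2, Finset.sum_neg_distrib] at h1
    linarith

/-- The functions F ε extend χ and differ by signs on cosets. Their average `biasSum` is at least
|G||H| = |G|²/[G:H], so one of them reaches this value. -/
theorem exists_zeroMean_extension (hχ : ∃ h, χ h = -1) (c : G ⧸ H → G)
    (hc : ∀ q, (c q : G ⧸ H) = q) (hcc : ∀ q, c q ^ 2 = 1) (hc1 : c ((1 : G) : G ⧸ H) = 1) :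
    ∃ f : G → ℤˣ, IsZeroMean f ∧ (∀ h : H, f h = χ h) ∧
      1 / 2 * (1 + 1 / (H.index : ℝ)) ≤ homProb f := by
  classical
  have hmem : ∀ x : G, (c (x : G ⧸ H))⁻¹ * x ∈ H := fun x => QuotientGroup.eq.1 (hc _)
  let s : G → ℤˣ := fun x => χ ⟨_, hmem x⟩
  have hs : ∀ x, signVal (s x) = extendZero H χ ((c (x : G ⧸ H))⁻¹ * x) :=
    fun x => (extendZero_of_mem χ (hmem x)).symm
  have hbar : ∀ x : G, ∀ h ∈ H, ((x * h : G) : G ⧸ H) = (x : G ⧸ H) :=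
    fun x h hh => QuotientGroup.mk_mul_of_mem x hh
  have hone : ∀ x : G, (x : G ⧸ H) = ((1 : G) : G ⧸ H) ↔ x ∈ H := fun x => by
    rw [eq_comm, QuotientGroup.eq, inv_one, one_mul]
  have hsmul : ∀ x : G, ∀ h (hh : h ∈ H), s (x * h) = s x * χ ⟨h, hh⟩ := by
    intro x h hh
    simp only [s]
    rw [← map_mul]
    congr 1
    apply Subtype.ext
    simp only [Subgroup.coe_mul]
    rw [hbar x h hh, mul_assoc]
  have hsH : ∀ h (hh : h ∈ H), s h = χ ⟨h, hh⟩ := by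
    intro h hh
    simp only [s]
    congr 1
    apply Subtype.ext
    change (c (h : G ⧸ H))⁻¹ * h = h
    rw [(hone h).2 hh, hc1, inv_one, one_mul]
  let o : G ⧸ H := ((1 : G) : G ⧸ H)
  -- The factor ε o makes F ε agree with χ on H. In a product of three values it leaves a single ε
  -- o, the fourth sign in `sum_signs_eq`.
  let F : (G ⧸ H → ℤˣ) → G → ℤˣ := fun ε x => ε x * ε o * s x
  have hFh : ∀ ε (x h : G) (hh : h ∈ H), F ε (x * h) = F ε x * χ ⟨h, hh⟩ := by
    intro ε x h hh
    simp only [F]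
    rw [hbar x h hh, hsmul x h hh, ← mul_assoc]
  let t : G → G → ℝ := fun x y => signVal (s x * s y * s (x * y))
  have hmain : (Fintype.card G : ℝ) * Nat.card H ≤ ∑ x : G, ∑ y : G,
      if (x : G ⧸ H) = o ∧ (y : G ⧸ H) = ((x * y : G) : G ⧸ H) ∨
        (y : G ⧸ H) = o ∧ (x : G ⧸ H) = ((x * y : G) : G ⧸ H) ∨
        ((x * y : G) : G ⧸ H) = o ∧ (x : G ⧸ H) = (y : G ⧸ H) then t x y else 0 := by
    rw [Finset.sum_comm]
    have hcard : (Fintype.card G : ℝ) * Nat.card H =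
        ∑ y : G, if y ∈ H then (Fintype.card G : ℝ) else 0 := by
      rw [← Finset.sum_filter, Finset.sum_const, nsmul_eq_mul, mul_comm, Nat.card_eq_fintype_card,
        Fintype.card_subtype]
    rw [hcard]
    refine Finset.sum_le_sum fun y _ => ?_
    split_ifs with hy
    · have : ∀ x : G, (if (x : G ⧸ H) = o ∧ (y : G ⧸ H) = ((x * y : G) : G ⧸ H) ∨
          (y : G ⧸ H) = o ∧ (x : G ⧸ H) = ((x * y : G) : G ⧸ H) ∨
          ((x * y : G) : G ⧸ H) = o ∧ (x : G ⧸ H) = (y : G ⧸ H) then t x y else 0) = 1 := by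
        intro x
        rw [if_pos (Or.inr (Or.inl ⟨(hone y).2 hy, (hbar x y hy).symm⟩))]
        simp only [t]
        rw [hsmul x y hy, hsH y hy, Int.units_mul_self, signVal_one]
      simp [this]
    -- For y outside H the middle pattern is impossible and the other two exclude each other. Each
    -- contributes χ(h)χ(g⁻¹hg): with h = x, g = y in the first, and h = c⁻¹x, g = c in the last,
    -- where c represents yH.
    · have hsplit : ∀ x : G, (if (x : G ⧸ H) = o ∧ (y : G ⧸ H) = ((x * y : G) : G ⧸ H) ∨
          (y : G ⧸ H) = o ∧ (x : G ⧸ H) = ((x * y : G) : G ⧸ H) ∨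
          ((x * y : G) : G ⧸ H) = o ∧ (x : G ⧸ H) = (y : G ⧸ H) then t x y else 0) =
          extendZero H χ x * extendZero H χ (y⁻¹ * x * y) +
          extendZero H χ ((c (y : G ⧸ H))⁻¹ * x) * extendZero H χ ((c (y : G ⧸ H))⁻¹ *
            ((c (y : G ⧸ H))⁻¹ * x) * c (y : G ⧸ H)) := by
        intro x
        have hy' : ¬ (y : G ⧸ H) = o := fun h => hy ((hone y).1 h)
        have e1 : (y : G ⧸ H) = ((x * y : G) : G ⧸ H) ↔ y⁻¹ * x * y ∈ H := by
          rw [QuotientGroup.eq, mul_assoc]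
        have hcinv : (c (y : G ⧸ H))⁻¹ = c (y : G ⧸ H) := by
          rw [inv_eq_iff_mul_eq_one, ← sq, hcc]
        have e2 : (x : G ⧸ H) = (y : G ⧸ H) ↔ (c (y : G ⧸ H))⁻¹ * x ∈ H := by
          rw [eq_comm, ← QuotientGroup.eq, hc]
        have e3 : (c (y : G ⧸ H))⁻¹ * ((c (y : G ⧸ H))⁻¹ * x) * c (y : G ⧸ H) ∈ H ↔
            ((x * y : G) : G ⧸ H) = o := by
          rw [hone, ← H.mul_mem_cancel_right (hmem y)]
          nth_rewrite 2 [hcinv]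
          simp [mul_assoc]
        have hA : extendZero H χ x * extendZero H χ (y⁻¹ * x * y) =
            if (x : G ⧸ H) = o ∧ (y : G ⧸ H) = ((x * y : G) : G ⧸ H) then t x y else 0 := by
          split_ifs with h
          · rw [e1, hone] at h
            have : x * y = y * (y⁻¹ * x * y) := by group
            simp only [t]
            rw [this, hsmul _ _ h.2, extendZero_of_mem χ h.1, extendZero_of_mem χ h.2, hsH x h.1,
              ← signVal_mul]
            have hcancel : ∀ a b u : ℤˣ, a * b = a * u * (u * b) := by
              intro a b u
              rw [mul_assoc, ← mul_assoc u, Int.units_mul_self, one_mul]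
            rw [hcancel _ _ (s y)]
          · rw [e1, hone] at h
            by_cases h1 : x ∈ H
            · rw [extendZero_of_notMem χ fun h2 => h ⟨h1, h2⟩, mul_zero]
            · rw [extendZero_of_notMem χ h1, zero_mul]
        have hB : extendZero H χ ((c (y : G ⧸ H))⁻¹ * x) * extendZero H χ ((c (y : G ⧸ H))⁻¹ *
            ((c (y : G ⧸ H))⁻¹ * x) * c (y : G ⧸ H)) =
            if ((x * y : G) : G ⧸ H) = o ∧ (x : G ⧸ H) = (y : G ⧸ H) then t x y else 0 := by
          split_ifs with h
          · rw [e2, ← e3] at h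
            -- Here c = c⁻¹ is essential: with x = ch and y = ck, xy = (chc)k becomes (c⁻¹hc)k.
            have hxy : x * y = ((c (y : G ⧸ H))⁻¹ * ((c (y : G ⧸ H))⁻¹ * x) * c (y : G ⧸ H)) *
                ((c (y : G ⧸ H))⁻¹ * y) := by
              nth_rewrite 1 [hcinv]
              simp [mul_assoc]
            have hsx : signVal (s x) = extendZero H χ ((c (y : G ⧸ H))⁻¹ * x) := by
              rw [hs, e2.2 h.2]
            have hsxy : signVal (s (x * y)) = extendZero H χ ((c (y : G ⧸ H))⁻¹ *
                ((c (y : G ⧸ H))⁻¹ * x) * c (y : G ⧸ H)) * signVal (s y) := by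
              have hm : x * y ∈ H := by rw [hxy]; exact H.mul_mem h.1 (hmem y)
              rw [hsH _ hm, ← extendZero_of_mem χ hm, hs y, ← extendZero_mul_left χ h.1, ← hxy]
            simp only [t]
            rw [signVal_mul, signVal_mul, hsxy, hsx]
            linear_combination (-(extendZero H χ ((c (y : G ⧸ H))⁻¹ * x) *
              extendZero H χ ((c (y : G ⧸ H))⁻¹ *
                ((c (y : G ⧸ H))⁻¹ * x) * c (y : G ⧸ H)))) * signVal_mul_self (s y)
          · rw [e2, ← e3] at h
            by_cases h1 : (c (y : G ⧸ H))⁻¹ * x ∈ H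
            · rw [extendZero_of_notMem χ (x := (c (y : G ⧸ H))⁻¹ *
                ((c (y : G ⧸ H))⁻¹ * x) * c (y : G ⧸ H)) fun h2 => h ⟨h2, h1⟩, mul_zero]
            · rw [extendZero_of_notMem χ h1, zero_mul]
        rw [hA, hB]
        by_cases p1 : (x : G ⧸ H) = o ∧ (y : G ⧸ H) = ((x * y : G) : G ⧸ H)
        · have p2 : ¬ (((x * y : G) : G ⧸ H) = o ∧ (x : G ⧸ H) = (y : G ⧸ H)) :=
            fun h => hy' (h.2.symm.trans p1.1)
          rw [if_pos (Or.inl p1), if_pos p1, if_neg p2, add_zero]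
        · by_cases p2 : ((x * y : G) : G ⧸ H) = o ∧ (x : G ⧸ H) = (y : G ⧸ H)
          · rw [if_pos (Or.inr (Or.inr p2)), if_neg p1, if_pos p2, zero_add]
          · rw [if_neg p1, if_neg p2, if_neg (by tauto), add_zero]
      simp only [hsplit, Finset.sum_add_distrib]
      refine add_nonneg (sum_extendZero_conj_nonneg χ y) ?_
      exact (sum_extendZero_conj_nonneg χ _).trans_eq
        (Equiv.sum_comp (Equiv.mulLeft (c (y : G ⧸ H))⁻¹) fun x =>
          extendZero H χ x * extendZero H χ ((c (y : G ⧸ H))⁻¹ * x * c (y : G ⧸ H))).symm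
  have hsum : ∑ ε, biasSum (F ε) = (Fintype.card (G ⧸ H → ℤˣ) : ℝ) * ∑ x : G, ∑ y : G,
      if (x : G ⧸ H) = o ∧ (y : G ⧸ H) = ((x * y : G) : G ⧸ H) ∨
        (y : G ⧸ H) = o ∧ (x : G ⧸ H) = ((x * y : G) : G ⧸ H) ∨
        ((x * y : G) : G ⧸ H) = o ∧ (x : G ⧸ H) = (y : G ⧸ H) then t x y else 0 := by
    unfold biasSum
    rw [Finset.sum_comm, Finset.mul_sum]
    refine Finset.sum_congr rfl fun x _ => ?_
    rw [Finset.sum_comm, Finset.mul_sum]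
    refine Finset.sum_congr rfl fun y _ => ?_
    have hterm : ∀ ε : G ⧸ H → ℤˣ, realSign (F ε) x * realSign (F ε) y * realSign (F ε) (x * y) =
        signVal (ε x * ε y * ε ((x * y : G) : G ⧸ H) * ε o) * t x y := by
      intro ε
      change signVal _ * signVal _ * signVal _ = _
      rw [← signVal_mul, ← signVal_mul, ← signVal_mul]
      have hprod : ∀ p q r u a b d : ℤˣ,
          p * u * a * (q * u * b) * (r * u * d) = p * q * r * u * (a * b * d) * (u * u) := by
        intro p q r u a b d
        ac_rfl
      rw [hprod, Int.units_mul_self, mul_one]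
    simp only [hterm]
    rw [← Finset.sum_mul, sum_signs_eq]
    split_ifs <;> simp
  obtain ⟨ε, -, hε⟩ := Finset.exists_le_of_sum_le (s := (univ : Finset (G ⧸ H → ℤˣ)))
    (f := fun _ => (Fintype.card G : ℝ) * Nat.card H) (g := fun ε => biasSum (F ε))
    univ_nonempty (by
      rw [hsum, Finset.sum_const, Finset.card_univ, nsmul_eq_mul]
      gcongr)
  refine ⟨F ε, ?_, ?_, ?_⟩
  · rw [isZeroMean_iff]
    obtain ⟨h, hh⟩ := hχ
    -- Right translation by h with χ h = -1 negates F ε, so the mean is zero for every ε.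
    have h1 := Equiv.sum_comp (Equiv.mulRight (h : G)) fun x => realSign (F ε) x
    have h2 : ∀ x, realSign (F ε) (x * h) = -realSign (F ε) x := by
      intro x
      change signVal _ = -signVal _
      rw [hFh ε x h h.2, hh, signVal_mul, signVal_neg_one, mul_neg_one]
    simp only [Equiv.coe_mulRight, h2, Finset.sum_neg_distrib] at h1
    linarith
  · intro h
    simp only [F]
    rw [(hone h).2 h.2, hsH h h.2]
    simp [o, Int.units_mul_self]
  · rw [homProb_eq]
    have hG : (0 : ℝ) < Fintype.card G := by exact_mod_cast Fintype.card_pos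
    have hi : (Nat.card H : ℝ) * H.index = Fintype.card G := by
      rw [← Nat.cast_mul, H.card_mul_index, Nat.card_eq_fintype_card]
    have hi0 : (0 : ℝ) < H.index := by
      have := H.index_ne_zero_of_finite
      exact_mod_cast Nat.pos_of_ne_zero this
    have : 1 / (H.index : ℝ) ≤ biasSum (F ε) / (Fintype.card G : ℝ) ^ 2 := by
      rw [div_le_div_iff₀ hi0 (by positivity)]
      calc 1 * (Fintype.card G : ℝ) ^ 2 = (Fintype.card G * Nat.card H) * H.index := by
            rw [mul_assoc, hi]; ring
        _ ≤ _ := by gcongr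
    linarith

end Averaging

/-! ### The stabilizer of a pair and its involutive coset representatives -/

section PairSubgroup

/-- The embedding of the last `n - 2` points. -/
def lastEmb (n : ℕ) : Fin (n - 2) ↪ Fin n :=
  ⟨lastPoint, fun i j h => Fin.ext (by
    have := congrArg Fin.val h
    simp only [lastPoint] at this
    omega)⟩

theorem lastEmb_apply {n : ℕ} (i : Fin (n - 2)) : lastEmb n i = lastPoint i := rfl

theorem val_lastEmb {n : ℕ} (i : Fin (n - 2)) : (lastEmb n i : ℕ) = i + 2 := rfl

theorem exists_lastEmb_eq {n : ℕ} {x : Fin n} (hx : 2 ≤ (x : ℕ)) : ∃ i, lastEmb n i = x :=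
  ⟨⟨x - 2, by omega⟩, Fin.ext (by rw [val_lastEmb]; simp only; omega)⟩

variable {n : ℕ} (hn : 2 ≤ n)

/-- The identity or the transposition of the first two points, according to a sign. -/
def swapOf (u : ℤˣ) : Perm (Fin n) :=
  if u = 1 then 1 else swap ⟨0, by omega⟩ ⟨1, by omega⟩

theorem swapOf_mul (u v : ℤˣ) : swapOf hn (u * v) = swapOf hn u * swapOf hn v := by
  rcases Int.units_eq_one_or u with rfl | rfl <;> rcases Int.units_eq_one_or v with rfl | rfl <;>
    simp [swapOf]

theorem sign_swapOf (u : ℤˣ) : Perm.sign (swapOf hn u) = u := by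
  rcases Int.units_eq_one_or u with rfl | rfl <;> simp [swapOf]

theorem swapOf_apply_of_le (u : ℤˣ) {x : Fin n} (hx : 2 ≤ (x : ℕ)) : swapOf hn u x = x := by
  unfold swapOf
  split_ifs
  · rfl
  · refine swap_apply_of_ne_of_ne ?_ ?_ <;> rintro rfl <;> simp at hx

theorem swapOf_apply_lt (u : ℤˣ) (x : Fin n) : ((swapOf hn u x : Fin n) : ℕ) < 2 ↔ (x : ℕ) < 2 := by
  by_cases hx : 2 ≤ (x : ℕ)
  · rw [swapOf_apply_of_le hn u hx]
  · unfold swapOf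
    split_ifs
    · rfl
    · rw [swap_apply_def]
      split_ifs <;> simp <;> omega

theorem viaEmbedding_lastEmb_of_lt (σ : Perm (Fin (n - 2))) {x : Fin n} (hx : (x : ℕ) < 2) :
    σ.viaEmbedding (lastEmb n) x = x := by
  refine Perm.viaEmbedding_apply_of_notMem _ _ _ ?_
  rintro ⟨i, rfl⟩
  rw [val_lastEmb] at hx
  omega

theorem viaEmbedding_lastEmb_lt (σ : Perm (Fin (n - 2))) (x : Fin n) :
    ((σ.viaEmbedding (lastEmb n) x : Fin n) : ℕ) < 2 ↔ (x : ℕ) < 2 := by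
  by_cases hx : (x : ℕ) < 2
  · rw [viaEmbedding_lastEmb_of_lt σ hx]
  · obtain ⟨i, rfl⟩ := exists_lastEmb_eq (not_lt.1 hx)
    rw [Perm.viaEmbedding_apply, val_lastEmb, val_lastEmb]
    omega

theorem commute_viaEmbedding_swapOf (σ : Perm (Fin (n - 2))) (u : ℤˣ) :
    Commute (σ.viaEmbedding (lastEmb n)) (swapOf hn u) := by
  refine Perm.Disjoint.commute fun x => ?_
  by_cases hx : (x : ℕ) < 2
  · exact Or.inl (viaEmbedding_lastEmb_of_lt σ hx)
  · exact Or.inr (swapOf_apply_of_le hn u (not_lt.1 hx))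

/-- The even permutation that acts as `σ` on the last `n - 2` points and switches the first two
points exactly when `σ` is odd. -/
noncomputable def evenExtension : Perm (Fin (n - 2)) →* pairSubgroup n where
  toFun σ := ⟨⟨σ.viaEmbedding (lastEmb n) * swapOf hn (Perm.sign σ), by
      rw [Perm.mem_alternatingGroup, Perm.sign_mul, sign_viaEmbedding, sign_swapOf,
        Int.units_mul_self]⟩, fun i => by
      change ((σ.viaEmbedding (lastEmb n) (swapOf hn (Perm.sign σ) i) : Fin n) : ℕ) < 2 ↔ _
      rw [viaEmbedding_lastEmb_lt, swapOf_apply_lt]⟩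
  map_one' := by
    apply Subtype.ext
    apply Subtype.ext
    change (Perm.viaEmbeddingHom (lastEmb n)) 1 * swapOf hn (Perm.sign 1) = 1
    simp [swapOf]
  map_mul' σ τ := by
    apply Subtype.ext
    apply Subtype.ext
    change (Perm.viaEmbeddingHom (lastEmb n)) (σ * τ) * swapOf hn (Perm.sign (σ * τ)) =
      ((Perm.viaEmbeddingHom (lastEmb n)) σ * swapOf hn (Perm.sign σ)) *
        ((Perm.viaEmbeddingHom (lastEmb n)) τ * swapOf hn (Perm.sign τ))
    rw [map_mul, Perm.sign_mul, swapOf_mul]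
    exact (commute_viaEmbedding_swapOf hn τ (Perm.sign σ)).mul_mul_mul_comm _ _

theorem coe_evenExtension (σ : Perm (Fin (n - 2))) :
    ((evenExtension hn σ : alternatingGroup (Fin n)) : Perm (Fin n)) =
      σ.viaEmbedding (lastEmb n) * swapOf hn (Perm.sign σ) := rfl

theorem evenExtension_apply_lastPoint (σ : Perm (Fin (n - 2))) (i : Fin (n - 2)) :
    ((evenExtension hn σ : alternatingGroup (Fin n)) : Perm (Fin n)) (lastPoint i) =
      lastPoint (σ i) := by
  rw [coe_evenExtension, Perm.mul_apply, swapOf_apply_of_le hn _ (by simp [lastPoint]),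
    ← lastEmb_apply, Perm.viaEmbedding_apply, lastEmb_apply]

/-- For surjectivity, undo the action on the first two points by `swapOf` of a sign u. What remains
comes from some σ on the last points, and evenness forces u = sgn σ. -/
theorem evenExtension_bijective : Function.Bijective (evenExtension hn) := by
  constructor
  · intro σ τ h
    ext1 i
    apply (lastEmb n).injective
    rw [lastEmb_apply, lastEmb_apply, ← evenExtension_apply_lastPoint hn,
      ← evenExtension_apply_lastPoint hn, h]
  · intro g
    have hg := g.2
    set p : Perm (Fin n) := ((g : alternatingGroup (Fin n)) : Perm (Fin n)) with hp
    obtain ⟨u, hu⟩ : ∃ u : ℤˣ, ∀ x : Fin n, (x : ℕ) < 2 → p (swapOf hn u x) = x := by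
      have h0 := (hg ⟨0, by omega⟩).2 (by simp)
      have h1 := (hg ⟨1, by omega⟩).2 (by simp)
      have hne : p ⟨0, by omega⟩ ≠ p ⟨1, by omega⟩ := p.injective.ne (by simp)
      have hne' := Fin.val_ne_of_ne hne
      rw [← hp] at h0 h1
      by_cases h : p ⟨0, by omega⟩ = ⟨0, by omega⟩
      · refine ⟨1, fun x hx => ?_⟩
        simp only [swapOf, if_true, Perm.one_apply]
        have hv := congrArg Fin.val h
        simp only at hv
        rcases (by omega : (x : ℕ) = 0 ∨ (x : ℕ) = 1) with e | e
        · rw [show x = ⟨0, by omega⟩ from Fin.ext e, h]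
        · rw [show x = ⟨1, by omega⟩ from Fin.ext e]
          apply Fin.ext
          simp only
          omega
      · refine ⟨-1, fun x hx => ?_⟩
        have hv : (p ⟨0, by omega⟩ : ℕ) ≠ 0 := fun e => h (Fin.ext e)
        have hs : swapOf hn (-1) = swap ⟨0, by omega⟩ ⟨1, by omega⟩ := if_neg (by decide)
        rw [hs]
        rcases (by omega : (x : ℕ) = 0 ∨ (x : ℕ) = 1) with e | e
        · rw [show x = ⟨0, by omega⟩ from Fin.ext e, swap_apply_left]
          apply Fin.ext
          simp only
          omega
        · rw [show x = ⟨1, by omega⟩ from Fin.ext e, swap_apply_right]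
          apply Fin.ext
          simp only
          omega
    obtain ⟨σ, hσ⟩ := exists_viaEmbedding_eq (lastEmb n) (g := p * swapOf hn u) (by
      intro x hx
      refine hu x ?_
      by_contra hlt
      obtain ⟨i, hi⟩ := exists_lastEmb_eq (not_lt.1 hlt)
      exact hx i hi)
    have hsign : Perm.sign σ = u := by
      rw [← sign_viaEmbedding (lastEmb n), hσ, Perm.sign_mul, sign_swapOf,
        Perm.mem_alternatingGroup.1 (g : alternatingGroup (Fin n)).2, one_mul]
    refine ⟨σ, Subtype.ext (Subtype.ext ?_)⟩
    rw [coe_evenExtension, hσ, hsign, mul_assoc, ← swapOf_mul, Int.units_mul_self]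
    simp [swapOf, hp]

/-- The isomorphism of the symmetric group on `n - 2` points with the stabilizer of the pair of the
first two points in the alternating group. -/
noncomputable def pairEquiv : Perm (Fin (n - 2)) ≃* pairSubgroup n :=
  MulEquiv.ofBijective (evenExtension hn) (evenExtension_bijective hn)

include hn in
theorem index_pairSubgroup : (pairSubgroup n).index = n.choose 2 := by
  have : Nontrivial (Fin n) := Fin.nontrivial_iff_two_le.2 hn
  have h1 := (pairSubgroup n).card_mul_index
  have h2 : Nat.card (pairSubgroup n) = (n - 2).factorial := by
    rw [← Nat.card_congr (pairEquiv hn).toEquiv, Nat.card_eq_fintype_card, Fintype.card_perm,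
      Fintype.card_fin]
  have h3 := two_mul_nat_card_alternatingGroup (α := Fin n)
  rw [Nat.card_eq_fintype_card (α := Perm (Fin n)), Fintype.card_perm, Fintype.card_fin,
    ← Nat.choose_mul_factorial_mul_factorial hn, ← h1, h2] at h3
  have hpos := (n - 2).factorial_pos
  rw [Nat.factorial_two] at h3
  have : (n - 2).factorial * (pairSubgroup n).index = (n - 2).factorial * n.choose 2 := by
    linarith
  exact Nat.eq_of_mul_eq_mul_left hpos this

include hn in
theorem mem_pairSubgroup_of_lt {g : alternatingGroup (Fin n)}
    (h0 : ((g : Perm (Fin n)) ⟨0, by omega⟩ : ℕ) < 2)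
    (h1 : ((g : Perm (Fin n)) ⟨1, by omega⟩ : ℕ) < 2) : g ∈ pairSubgroup n := by
  intro i
  have hne := Fin.val_ne_of_ne ((g : Perm (Fin n)).injective.ne
    (show (⟨0, by omega⟩ : Fin n) ≠ ⟨1, by omega⟩ by simp))
  constructor
  · intro hi
    by_contra hi2
    have e0 := Fin.val_ne_of_ne ((g : Perm (Fin n)).injective.ne
      (show i ≠ ⟨0, by omega⟩ from fun e => hi2 (by rw [e]; simp)))
    have e1 := Fin.val_ne_of_ne ((g : Perm (Fin n)).injective.ne
      (show i ≠ ⟨1, by omega⟩ from fun e => hi2 (by rw [e]; simp)))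
    omega
  · intro hi
    rcases (by omega : (i : ℕ) = 0 ∨ (i : ℕ) = 1) with e | e
    · rwa [show i = ⟨0, by omega⟩ from Fin.ext e]
    · rwa [show i = ⟨1, by omega⟩ from Fin.ext e]

theorem exists_double_transposition {w x y z : Fin n} (hwx : w ≠ x) (hyz : y ≠ z) (hwy : w ≠ y)
    (hwz : w ≠ z) (hxy : x ≠ y) (hxz : x ≠ z) :
    ∃ c : alternatingGroup (Fin n), (c : Perm (Fin n)) = swap w x * swap y z ∧ c ^ 2 = 1 := by
  have hcomm : Commute (swap w x) (swap y z) := by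
    refine Perm.Disjoint.commute fun i => ?_
    by_cases h : i = w ∨ i = x
    · right
      rcases h with rfl | rfl
      exacts [swap_apply_of_ne_of_ne hwy hwz, swap_apply_of_ne_of_ne hxy hxz]
    · push Not at h
      exact Or.inl (swap_apply_of_ne_of_ne h.1 h.2)
  refine ⟨⟨swap w x * swap y z, ?_⟩, rfl, Subtype.ext ?_⟩
  · rw [Perm.mem_alternatingGroup, Perm.sign_mul, Perm.sign_swap hwx, Perm.sign_swap hyz]
    rfl
  · change (swap w x * swap y z) ^ 2 = 1
    rw [hcomm.mul_pow, sq, sq, swap_mul_self, swap_mul_self, one_mul]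

theorem exists_involution_of_lt_of_le (hn5 : 5 ≤ n) {a b : Fin n} (ha : (a : ℕ) < 2)
    (hb : 2 ≤ (b : ℕ)) : ∃ c : alternatingGroup (Fin n), c ^ 2 = 1 ∧
      ((c : Perm (Fin n)) a : ℕ) < 2 ∧ ((c : Perm (Fin n)) b : ℕ) < 2 := by
  obtain ⟨a', ha', haa'⟩ : ∃ a' : Fin n, (a' : ℕ) < 2 ∧ a' ≠ a :=
    ⟨⟨1 - a, by omega⟩, by simp only; omega, fun e => by
      have := congrArg Fin.val e
      simp only at this
      omega⟩
  -- The involution will be (a' b)(x y); the spare transposition (x y), needed for evenness, is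
  -- where five points are required.
  have hcard : 1 < (univ \ {a, a', b} : Finset (Fin n)).card := by
    have := Finset.le_card_sdiff ({a, a', b} : Finset (Fin n)) univ
    have h3 : ({a, a', b} : Finset (Fin n)).card ≤ 3 := Finset.card_le_three
    rw [Finset.card_fin] at this
    omega
  obtain ⟨x, hx, y, hy, hxy⟩ := Finset.one_lt_card.1 hcard
  simp only [Finset.mem_sdiff, Finset.mem_univ, true_and, Finset.mem_insert, Finset.mem_singleton,
    not_or] at hx hy
  have ha'b : a' ≠ b := fun e => by rw [e] at ha'; omega
  have hab : a ≠ b := fun e => by rw [e] at ha; omega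
  obtain ⟨c, hc, hcc⟩ := exists_double_transposition ha'b hxy (Ne.symm hx.2.1) (Ne.symm hy.2.1)
    (Ne.symm hx.2.2) (Ne.symm hy.2.2)
  refine ⟨c, hcc, ?_, ?_⟩
  · rw [hc, Perm.mul_apply, swap_apply_of_ne_of_ne (Ne.symm hx.1) (Ne.symm hy.1),
      swap_apply_of_ne_of_ne haa'.symm hab]
    exact ha
  · rw [hc, Perm.mul_apply, swap_apply_of_ne_of_ne (Ne.symm hx.2.2) (Ne.symm hy.2.2),
      swap_apply_right]
    exact ha'

/-- The coset of g is determined by the pair {g 0, g 1}, so an even involution carrying this pair to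
the first two points suffices. If both points lie outside, it is (0 a)(1 b). -/
theorem exists_involution_mem_coset (hn5 : 5 ≤ n) (g : alternatingGroup (Fin n)) :
    ∃ c : alternatingGroup (Fin n), c ^ 2 = 1 ∧ c⁻¹ * g ∈ pairSubgroup n := by
  set a := (g : Perm (Fin n)) ⟨0, by omega⟩ with ha
  set b := (g : Perm (Fin n)) ⟨1, by omega⟩ with hb
  have hab : a ≠ b := (g : Perm (Fin n)).injective.ne (by simp)
  obtain ⟨c, hcc, hca, hcb⟩ : ∃ c : alternatingGroup (Fin n), c ^ 2 = 1 ∧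
      ((c : Perm (Fin n)) a : ℕ) < 2 ∧ ((c : Perm (Fin n)) b : ℕ) < 2 := by
    by_cases ha2 : (a : ℕ) < 2
    · by_cases hb2 : (b : ℕ) < 2
      · exact ⟨1, one_pow 2, ha2, hb2⟩
      · exact exists_involution_of_lt_of_le hn5 ha2 (not_lt.1 hb2)
    · by_cases hb2 : (b : ℕ) < 2
      · obtain ⟨c, hcc, h1, h2⟩ := exists_involution_of_lt_of_le hn5 hb2 (not_lt.1 ha2)
        exact ⟨c, hcc, h2, h1⟩
      · have ne : ∀ {x y : Fin n}, (x : ℕ) < 2 → ¬ (y : ℕ) < 2 → x ≠ y :=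
          fun hx hy e => hy (e ▸ hx)
        have h0 : (((⟨0, by omega⟩ : Fin n) : ℕ)) < 2 := by simp
        have h1 : (((⟨1, by omega⟩ : Fin n) : ℕ)) < 2 := by simp
        obtain ⟨c, hc, hcc⟩ := exists_double_transposition (ne h0 ha2) (ne h1 hb2) (by simp)
          (ne h0 hb2) (ne h1 ha2).symm hab
        refine ⟨c, hcc, ?_, ?_⟩
        · rw [hc, Perm.mul_apply, swap_apply_of_ne_of_ne (ne h1 ha2).symm hab, swap_apply_right]
          exact h0
        · rw [hc, Perm.mul_apply, swap_apply_right, swap_apply_of_ne_of_ne (by simp) (ne h1 ha2)]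
          exact h1
  have hinv : c⁻¹ = c := by rw [inv_eq_iff_mul_eq_one, ← sq, hcc]
  refine ⟨c, hcc, ?_⟩
  rw [hinv]
  exact mem_pairSubgroup_of_lt (by omega) hca hcb

theorem exists_involutive_section (hn5 : 5 ≤ n) :
    ∃ c : alternatingGroup (Fin n) ⧸ pairSubgroup n → alternatingGroup (Fin n),
      (∀ q, (c q : alternatingGroup (Fin n) ⧸ pairSubgroup n) = q) ∧ (∀ q, c q ^ 2 = 1) ∧
      c ((1 : alternatingGroup (Fin n)) : alternatingGroup (Fin n) ⧸ pairSubgroup n) = 1 := by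
  classical
  have h : ∀ q : alternatingGroup (Fin n) ⧸ pairSubgroup n, ∃ c : alternatingGroup (Fin n),
      (c : alternatingGroup (Fin n) ⧸ pairSubgroup n) = q ∧ c ^ 2 = 1 := by
    intro q
    obtain ⟨g, rfl⟩ := QuotientGroup.mk_surjective q
    obtain ⟨c, hcc, hc⟩ := exists_involution_mem_coset hn5 g
    exact ⟨c, QuotientGroup.eq.2 hc, hcc⟩
  choose c hc hcc using h
  -- The averaging argument needs the representative 1 for the subgroup itself.
  refine ⟨Function.update c ((1 : alternatingGroup (Fin n)) : _ ⧸ pairSubgroup n) 1, ?_, ?_, ?_⟩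
  · intro q
    by_cases hq : q = ((1 : alternatingGroup (Fin n)) : _ ⧸ pairSubgroup n)
    · rw [hq, Function.update_self]
    · rw [Function.update_of_ne hq, hc]
  · intro q
    by_cases hq : q = ((1 : alternatingGroup (Fin n)) : _ ⧸ pairSubgroup n)
    · rw [hq, Function.update_self, one_pow]
    · rw [Function.update_of_ne hq, hcc]
  · rw [Function.update_self]

theorem exists_zeroMean_sign_extension (hn5 : 5 ≤ n) :
    ∃ f : alternatingGroup (Fin n) → ℤˣ, IsZeroMean f ∧
      (∀ σ : Perm (Fin (n - 2)), f (pairEquiv hn σ : alternatingGroup (Fin n)) = Perm.sign σ) ∧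
      1 / 2 * (1 + 1 / (n.choose 2 : ℝ)) ≤ homProb f := by
  obtain ⟨c, hc, hcc, hc1⟩ := exists_involutive_section hn5
  let χ : pairSubgroup n →* ℤˣ := Perm.sign.comp (pairEquiv hn).symm.toMonoidHom
  have hχ : ∀ σ, χ (pairEquiv hn σ) = Perm.sign σ := by
    intro σ
    simp [χ]
  have hodd : ∃ h, χ h = -1 := by
    have hne : (⟨0, by omega⟩ : Fin (n - 2)) ≠ ⟨1, by omega⟩ := by simp
    exact ⟨pairEquiv hn (swap _ _), (hχ _).trans (Perm.sign_swap hne)⟩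
  obtain ⟨f, hf0, hf, hP⟩ := exists_zeroMean_extension χ hodd c hc hcc hc1
  rw [index_pairSubgroup hn] at hP
  exact ⟨f, hf0, fun σ => (hf _).trans (hχ σ), hP⟩

end PairSubgroup

/-! ### The order of magnitude of the best bias -/

section Extremal

/-- The sign on `A_4` that tells whether the image of the first point is among the first two. -/
def imageSign (g : alternatingGroup (Fin 4)) : ℤˣ := if (g : Perm (Fin 4)) 0 < 2 then 1 else -1

theorem isZeroMean_imageSign : IsZeroMean imageSign := by
  rw [isZeroMean_iff]
  unfold realSign
  rw [← Int.cast_sum]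
  have : ∑ x, ((imageSign x : ℤˣ) : ℤ) = 0 := by decide +kernel
  rw [this, Int.cast_zero]

theorem homProb_imageSign : homProb imageSign = 2 / 3 := by
  unfold homProb
  have h1 : (univ.filter fun p : alternatingGroup (Fin 4) × alternatingGroup (Fin 4) =>
      imageSign p.1 * imageSign p.2 = imageSign (p.1 * p.2)).card = 96 := by decide +kernel
  have h2 : Fintype.card (alternatingGroup (Fin 4) × alternatingGroup (Fin 4)) = 144 := by
    decide +kernel
  rw [h1, h2]
  norm_num

theorem homProb_le_one {G : Type*} [Group G] [Fintype G] (f : G → ℤˣ) : homProb f ≤ 1 := by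
  unfold homProb
  rw [div_le_one (by exact_mod_cast Fintype.card_pos)]
  exact_mod_cast Finset.card_le_univ _

/-- The constant 1 works because half of 1/(n choose 2) is 1/(n(n - 1)). The involutive
representatives need five points, so n = 4 uses an explicit function with bias 1/6. -/
theorem exists_mem_biases {n : ℕ} (hn : 4 ≤ n) :
    ∃ b ∈ biases n, 1 * (n : ℝ) ^ (-2 : ℝ) ≤ b := by
  have hn0 : (4 : ℝ) ≤ n := by exact_mod_cast hn
  have hpow : (n : ℝ) ^ (-2 : ℝ) = 1 / (n : ℝ) ^ 2 := by
    rw [Real.rpow_neg (by positivity), one_div]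
    norm_cast
  rw [one_mul, hpow]
  rcases hn.eq_or_lt with rfl | hn5
  · refine ⟨_, ⟨imageSign, isZeroMean_imageSign, rfl⟩, ?_⟩
    rw [homProb_imageSign]
    norm_num
  · obtain ⟨f, hf, -, hP⟩ := exists_zeroMean_sign_extension (n := n) (by omega) hn5
    refine ⟨_, ⟨f, hf, rfl⟩, ?_⟩
    have hchoose : (n.choose 2 : ℝ) = n * (n - 1) / 2 := Nat.cast_choose_two ℝ n
    have : 1 / (n : ℝ) ^ 2 ≤ 1 / 2 * (1 / (n.choose 2 : ℝ)) := by
      rw [hchoose, one_div_div, ← mul_div_assoc, one_div_mul_cancel two_ne_zero]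
      refine one_div_le_one_div_of_le (by nlinarith) (by nlinarith)
    linarith

/-- The constant 2 is generous: for n = 4 and n = 5 the trivial bound 1/2 on the bias is enough, and
for larger n the spectral bound is. -/
theorem bias_le {n : ℕ} (hn : 4 ≤ n) {b : ℝ} (hb : b ∈ biases n) :
    b ≤ 2 * (n : ℝ) ^ (-(1 / 2) : ℝ) := by
  obtain ⟨f, hf, rfl⟩ := hb
  have hn0 : (4 : ℝ) ≤ n := by exact_mod_cast hn
  have hs : 0 < √(n : ℝ) := Real.sqrt_pos.2 (by linarith)
  have hpow : (n : ℝ) ^ (-(1 / 2) : ℝ) = 1 / √(n : ℝ) := by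
    rw [Real.rpow_neg (by positivity), ← Real.sqrt_eq_rpow, one_div]
  rw [hpow, mul_one_div]
  rcases lt_or_ge n 6 with h6 | h6
  · have h1 := homProb_le_one f
    have hn6 : (n : ℝ) ≤ 16 := by exact_mod_cast (by omega : n ≤ 16)
    have h4 : √(n : ℝ) ≤ 4 := Real.sqrt_le_iff.2 ⟨by norm_num, by linarith⟩
    have : 1 / 2 ≤ 2 / √(n : ℝ) := by
      rw [div_le_div_iff₀ two_pos hs]
      linarith
    linarith
  · have h1 := homProb_alternatingGroup_le h6 f hf
    have hs1 : 0 < √((n : ℝ) - 1) := Real.sqrt_pos.2 (by linarith)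
    have h4 : √(n : ℝ) ≤ 4 * √((n : ℝ) - 1) := by
      rw [Real.sqrt_le_iff]
      refine ⟨by positivity, ?_⟩
      rw [mul_pow, Real.sq_sqrt (by linarith)]
      linarith
    have : 1 / 2 * (1 / √((n : ℝ) - 1)) ≤ 2 / √(n : ℝ) := by
      rw [div_mul_div_comm, div_le_div_iff₀ (by positivity) hs]
      linarith
    linarith

theorem exists_isGreatest_biases {n : ℕ} (hn : 4 ≤ n) : ∃ m, IsGreatest (biases n) m := by
  have hfin : (biases n).Finite := by
    refine (Set.finite_range fun f : alternatingGroup (Fin n) → ℤˣ => homProb f - 1 / 2).subset ?_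
    rintro _ ⟨f, -, rfl⟩
    exact ⟨f, rfl⟩
  obtain ⟨b, hb, -⟩ := exists_mem_biases hn
  exact hfin.isCompact.exists_isGreatest ⟨b, hb⟩

end Extremal

end ApproxParity

theorem mainTheorem5 :
    -- the subgroup isomorphic to the symmetric group, and the lower bound that it gives
    (∀ n : ℕ, 2 ≤ n →
      ∃ e : Equiv.Perm (Fin (n - 2)) ≃* ApproxParity.pairSubgroup n,
        (∀ (σ : Equiv.Perm (Fin (n - 2))) (i : Fin (n - 2)),
          ((e σ : alternatingGroup (Fin n)) : Equiv.Perm (Fin n)) (ApproxParity.lastPoint i) =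
            ApproxParity.lastPoint (σ i)) ∧
        (ApproxParity.pairSubgroup n).index = n.choose 2 ∧
        (5 ≤ n →
          (∃ T : Set (alternatingGroup (Fin n)),
            Subgroup.IsComplement T (ApproxParity.pairSubgroup n : Set (alternatingGroup (Fin n))) ∧
              ∀ c ∈ T, c ^ 2 = 1) ∧
          ∃ f : alternatingGroup (Fin n) → ℤˣ,
            ApproxParity.IsZeroMean f ∧
            (∀ σ : Equiv.Perm (Fin (n - 2)),
              f (e σ : alternatingGroup (Fin n)) = Equiv.Perm.sign σ) ∧
            1 / 2 * (1 + 1 / (n.choose 2 : ℝ)) ≤ ApproxParity.homProb f)) ∧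
    -- the smallest nontrivial irreducible representation, and the upper bound that it gives
    (∀ n : ℕ, 6 ≤ n →
      IsLeast (ApproxParity.nontrivialIrrepDims (alternatingGroup (Fin n))) (n - 1) ∧
      ∀ f : alternatingGroup (Fin n) → ℤˣ, ApproxParity.IsZeroMean f →
        ApproxParity.homProb f ≤ 1 / 2 * (1 + 1 / √((n : ℝ) - 1))) ∧
    -- the order of magnitude of the best bias
    (∃ c C : ℝ, 0 < c ∧ 0 < C ∧ ∀ n : ℕ, 4 ≤ n →
      ∃ m : ℝ, IsGreatest (ApproxParity.biases n) m ∧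
        c * (n : ℝ) ^ (-2 : ℝ) ≤ m ∧ m ≤ C * (n : ℝ) ^ (-(1 / 2) : ℝ)) := by
  refine ⟨fun n hn => ⟨ApproxParity.pairEquiv hn,
    ApproxParity.evenExtension_apply_lastPoint hn, ApproxParity.index_pairSubgroup hn,
    fun hn5 => ⟨?_, ApproxParity.exists_zeroMean_sign_extension hn hn5⟩⟩,
    fun n hn => ⟨ApproxParity.isLeast_nontrivialIrrepDims hn,
      ApproxParity.homProb_alternatingGroup_le hn⟩,
    1, 2, one_pos, two_pos, fun n hn => ?_⟩
  · obtain ⟨c, hc, hcc, -⟩ := ApproxParity.exists_involutive_section hn5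
    refine ⟨Set.range c, Subgroup.isComplement_range_left hc, ?_⟩
    rintro _ ⟨q, rfl⟩
    exact hcc q
  · obtain ⟨m, hm⟩ := ApproxParity.exists_isGreatest_biases hn
    obtain ⟨b, hb, hle⟩ := ApproxParity.exists_mem_biases hn
    exact ⟨m, hm, hle.trans (hm.2 hb), ApproxParity.bias_le hn hm.1⟩
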